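/- **Definitions.** Let $d\ge 1$. A *recursive tiling* in $\mathbb{R}^d$ is given by a finite set of rules and a starting rule. Each rule specifies a compact region with non-empty interior, a subdivision of this region into a finite number (at least two) of interior-disjoint tiles whose union is the region, and, for each of these tiles, a rule together with a similarity transformation (rotation, reflection, scaling and translation) that maps the region of that rule onto the tile; the tile is subdivided recursively by applying that rule under this transformation. The region $U$ of the starting rule is the *unit tile*. The *tiles* of the tiling are $U$ and all tiles obtained from it at any level of recursion. The tiling is *uniform* if all tiles have the same shape (up to similarity), all rules have the same number of tiles, and within each rule all tiles have the same volume; it is a *uniform hypercube tiling* if moreover the tiles are $d$-dimensional hypercubes. A *space-filling curve* (scanning order) based on a recursive tiling specifies in addition, for each rule, an order of the tiles of that rule and, for each of these tiles, whether the rule applied to it is applied with its order reversed. Thus, for each $k$, the tiles at depth $k$ of the recursion are put in a linear order. A *curve fragment* is the union of a set of consecutive tiles in this order, at some depth of recursion. The *Arrwwid number* of a recursive tiling (respectively, of a space-filling curve) with unit tile $U$ is the smallest number $a$ for which there is a constant $c$ such that every ball $Q\subseteq U$ can be covered by at most $a$ tiles (respectively, curve fragments) with total volume at most $c\cdot\mathrm{volume}(Q)$.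 **Theorem.** For every $d\ge 1$, any uniform hypercube tiling in $\mathbb{R}^d$ has Arrwwid number $2^d$, and any space-filling curve based on it has Arrwwid number $2^d-1$ or $2^d$. In particular, for $d=3$, any space-filling curve based on a uniform cube tiling has Arrwwid number at least $7$. -/

import Mathlib

open MeasureTheory
open scoped NNReal ENNReal

/-- A recursive tiling in `ℝ^d`, given by finitely many rules. The rule `r` tiles the region
`region r` with `size r` tiles; the `i`-th tile is the image of the region of the rule `child r i`
under the similarity transformation `place r i` (this may rotate, mirror, scale and translate), and
it is subdivided further by applying the rule `child r i`, transformed by `place r i`. The tiles of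
a rule have disjoint interiors, and their union is the region of the rule.
The recursion starts with the rule `root`. -/
structure RecursiveTiling (d : ℕ) where
  Rule : Type
  finite_rule : Finite Rule
  root : Rule
  region : Rule → Set (EuclideanSpace ℝ (Fin d))
  size : Rule → ℕ
  child : (r : Rule) → Fin (size r) → Rule
  place : (r : Rule) → Fin (size r) → (EuclideanSpace ℝ (Fin d) ≃ᵈ EuclideanSpace ℝ (Fin d))
  isCompact_region : ∀ r, IsCompact (region r)
  interior_region_nonempty : ∀ r, (interior (region r)).Nonempty
  two_le_size : ∀ r, 2 ≤ size r
  region_eq : ∀ r, region r = ⋃ i, place r i '' region (child r i)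
  disjoint_interior : ∀ r i j, i ≠ j →
    Disjoint (interior (place r i '' region (child r i)))
      (interior (place r j '' region (child r j)))

namespace RecursiveTiling

variable {d : ℕ}

/-- The unit tile: the region filled by the tiling. -/
def unitTile (T : RecursiveTiling d) : Set (EuclideanSpace ℝ (Fin d)) :=
  T.region T.root

/-- The tiles into which the region of the rule `r` is subdivided after expanding the recursion
to depth `k`. -/
def tilesAt (T : RecursiveTiling d) : ℕ → T.Rule → Set (Set (EuclideanSpace ℝ (Fin d)))
  | 0, r => {T.region r}
  | k + 1, r =>
      {A | ∃ i : Fin (T.size r), ∃ B ∈ T.tilesAt k (T.child r i), A = T.place r i '' B}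

/-- The tiles of the recursive tiling, of all levels of recursion (including the unit tile). -/
def IsTile (T : RecursiveTiling d) (A : Set (EuclideanSpace ℝ (Fin d))) : Prop :=
  ∃ k, A ∈ T.tilesAt k T.root

/-- A tiling is uniform if all tiles have the same shape (they are similar to each other), and each
rule subdivides such a shape into an equal number of tiles of equal size. -/
def IsUniform (T : RecursiveTiling d) : Prop :=
  (∀ r r' : T.Rule, ∃ f : EuclideanSpace ℝ (Fin d) ≃ᵈ EuclideanSpace ℝ (Fin d),
    T.region r' = f '' T.region r) ∧
  (∀ r r' : T.Rule, T.size r = T.size r') ∧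
  (∀ (r : T.Rule) (i j : Fin (T.size r)),
    volume (T.place r i '' T.region (T.child r i)) =
      volume (T.place r j '' T.region (T.child r j)))

end RecursiveTiling

/-- A `d`-dimensional hypercube, of any size, in any position and orientation: a set that is
similar to `[0,1]^d`. -/
def IsHypercube {d : ℕ} (A : Set (EuclideanSpace ℝ (Fin d))) : Prop :=
  ∃ f : EuclideanSpace ℝ (Fin d) ≃ᵈ EuclideanSpace ℝ (Fin d),
    A = f '' {x | ∀ i, x i ∈ Set.Icc (0 : ℝ) 1}

/-- A uniform hypercube tiling: a uniform recursive tiling whose tiles are hypercubes. -/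
def RecursiveTiling.IsUniformHypercubeTiling {d : ℕ} (T : RecursiveTiling d) : Prop :=
  T.IsUniform ∧ ∀ r, IsHypercube (T.region r)

/-- A family `P` of regions covers all balls in `U` with at most `a` regions per ball, and with
bounded cover ratio: for some constant `c`, every ball `Q` that lies entirely in `U` can be covered
by at most `a` regions from `P` with total volume at most `c` times the volume of `Q`. -/
def CoversBallsWith {d : ℕ} (U : Set (EuclideanSpace ℝ (Fin d)))
    (P : Set (EuclideanSpace ℝ (Fin d)) → Prop) (a : ℕ) : Prop :=
  ∃ c : ℝ≥0, ∀ (x : EuclideanSpace ℝ (Fin d)) (ρ : ℝ), 0 < ρ → Metric.closedBall x ρ ⊆ U →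
    ∃ F : Finset (Set (EuclideanSpace ℝ (Fin d))),
      F.card ≤ a ∧ (∀ A ∈ F, P A) ∧ Metric.closedBall x ρ ⊆ (⋃ A ∈ F, A) ∧
      ∑ A ∈ F, volume A ≤ (c : ℝ≥0∞) * volume (Metric.closedBall x ρ)

/-- `a` is the Arrwwid number of the recursive tiling `T`. -/
def RecursiveTiling.IsArrwwidNumber {d : ℕ} (T : RecursiveTiling d) (a : ℕ) : Prop :=
  IsLeast {a | CoversBallsWith T.unitTile T.IsTile a} a

/-- A recursive scanning order (recursive space-filling curve) based on the recursive tiling `T`: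
for each rule `r` an order of its tiles (`order r p` is the tile in position `p`), and for each tile
whether the rule that is applied to it is applied with reversed order. -/
structure ScanningOrder {d : ℕ} (T : RecursiveTiling d) where
  order : (r : T.Rule) → Fin (T.size r) ≃ Fin (T.size r)
  reversed : (r : T.Rule) → Fin (T.size r) → Bool

namespace ScanningOrder

variable {d : ℕ} {T : RecursiveTiling d}

/-- The tiles into which the region of the rule `r` is subdivided after expanding the recursion
to depth `k`, listed in scanning order. -/
def scan (S : ScanningOrder T) : ℕ → T.Rule → List (Set (EuclideanSpace ℝ (Fin d)))
  | 0, r => [T.region r]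
  | k + 1, r => (List.finRange (T.size r)).flatMap fun p =>
      let i := S.order r p
      let L := (S.scan k (T.child r i)).map fun A => T.place r i '' A
      if S.reversed r i then L.reverse else L

/-- A curve fragment: a set of tiles that are consecutive in the scanning order, at some depth of
recursion, considered as a region. (Consecutive tiles from several levels of recursion can be
subdivided to a common depth, so this is no restriction.) -/
def IsFragment (S : ScanningOrder T) (A : Set (EuclideanSpace ℝ (Fin d))) : Prop :=
  ∃ (k : ℕ) (L : List (Set (EuclideanSpace ℝ (Fin d)))),
    L <:+: S.scan k T.root ∧ A = ⋃ B ∈ L, B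

/-- `a` is the Arrwwid number of the space-filling curve `S`. -/
def IsArrwwidNumber (S : ScanningOrder T) (a : ℕ) : Prop :=
  IsLeast {a | CoversBallsWith T.unitTile S.IsFragment a} a

end ScanningOrder

/-! A similarity turns the unit tile into the unit cube, and uniformity makes the `n ^ k` tiles at
depth `k` congruent cubes. Congruent cubes can fill a cube only as a grid (`exists_eq_gridCell`), so
`n = m ^ d`, and the tiles at depth `k` are the cells of the grid of mesh `m ^ (-k)`
(`CubeRefinement.exists_mesh`).

Upper bound: at the finest mesh that is at least its diameter, a ball is covered by two layers of
cells per axis, hence by `2 ^ d` tiles of comparable size. A tile is a fragment, so the bound holds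
for curves too.

Lower bound for tiles: cover a tiny ball around an inner grid vertex. The volume bound forces all
covering sets to be smaller than tiles of a chosen greater depth
(`exists_small_sets_around_vertex`), so no covering tile reaches two of the `2 ^ d` cells at the
vertex.

Lower bound for fragments: a small fragment that visits two cells leaves the earlier one through its
last small subtile (`CubeRefinement.mem_last_subtile`), so that subtile lies close to the vertex. If
`2 ^ d - 2` fragments sufficed, every inner vertex would have at least two such cells. But the last
subtile of a cell is close to at most one vertex, so there would be at least twice as many cells as
inner vertices. In a fine grid this is false, since `M ^ d < 2 * (M - 1) ^ d` for `M > 2 * d`. -/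

/-- The axis-parallel cube of side `s` whose least corner is `a`. -/
def cubeAt {d : ℕ} (a : Fin d → ℝ) (s : ℝ) : Set (EuclideanSpace ℝ (Fin d)) :=
  {x | ∀ i, x i ∈ Set.Icc (a i) (a i + s)}

/-- The cell with index `z` of the cubical grid of mesh `s`. -/
def gridCell {d : ℕ} (s : ℝ) (z : Fin d → ℕ) : Set (EuclideanSpace ℝ (Fin d)) :=
  cubeAt (fun i => s * z i) s

/-- The unit cube. -/
def unitCube (d : ℕ) : Set (EuclideanSpace ℝ (Fin d)) :=
  {x | ∀ i, x i ∈ Set.Icc (0 : ℝ) 1}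

/-! ### Similarities of Euclidean space -/

section Dilations

variable {d : ℕ}

/-- Dividing by the ratio leaves a surjective isometry, which is affine by Mazur–Ulam. -/
theorem DilationEquiv.exists_eq_add_smul
    (f : EuclideanSpace ℝ (Fin d) ≃ᵈ EuclideanSpace ℝ (Fin d)) :
    ∃ (b : EuclideanSpace ℝ (Fin d)) (s : ℝ)
      (L : EuclideanSpace ℝ (Fin d) ≃ₗᵢ[ℝ] EuclideanSpace ℝ (Fin d)), 0 < s ∧
      ∀ x, f x = b + s • L x := by
  set s : ℝ := (Dilation.ratio f : ℝ) with hs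
  have hs0 : 0 < s := by
    rw [hs]; exact_mod_cast Dilation.ratio_pos f
  let e : EuclideanSpace ℝ (Fin d) ≃ EuclideanSpace ℝ (Fin d) :=
    f.toEquiv.trans (Equiv.smulRight (inv_ne_zero hs0.ne'))
  let g : EuclideanSpace ℝ (Fin d) ≃ᵢ EuclideanSpace ℝ (Fin d) := IsometryEquiv.mk e (by
    refine Isometry.of_dist_eq fun x y => ?_
    change dist (s⁻¹ • f x) (s⁻¹ • f y) = _
    rw [dist_smul₀, Dilation.dist_eq f x y, Real.norm_of_nonneg (inv_nonneg.2 hs0.le),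
      ← hs, inv_mul_cancel_left₀ hs0.ne'])
  refine ⟨f 0, s, g.toRealLinearIsometryEquiv, hs0, fun x => ?_⟩
  rw [IsometryEquiv.toRealLinearIsometryEquiv_apply]
  have hg : ∀ x, g x = s⁻¹ • f x := fun x => rfl
  rw [hg, hg, ← smul_sub, smul_inv_smul₀ hs0.ne']
  abel

open scoped Pointwise in
theorem image_add_smul (b : EuclideanSpace ℝ (Fin d)) (s : ℝ)
    (L : EuclideanSpace ℝ (Fin d) ≃ₗᵢ[ℝ] EuclideanSpace ℝ (Fin d))
    (A : Set (EuclideanSpace ℝ (Fin d))) :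
    (fun x => b + s • L x) '' A = (fun x => b + x) '' (s • (L '' A)) := by
  rw [← Set.image_smul, Set.image_image, Set.image_image]

open scoped Pointwise in
theorem volume_image_add_smul (b : EuclideanSpace ℝ (Fin d)) {s : ℝ} (hs : 0 < s)
    (L : EuclideanSpace ℝ (Fin d) ≃ₗᵢ[ℝ] EuclideanSpace ℝ (Fin d))
    (A : Set (EuclideanSpace ℝ (Fin d))) :
    volume ((fun x => b + s • L x) '' A) = ENNReal.ofReal (s ^ d) * volume A := by
  rw [image_add_smul, Set.image_add_left, measure_preimage_add, Measure.addHaar_smul,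
    finrank_euclideanSpace_fin, abs_of_pos (pow_pos hs d)]
  congr 1
  have := L.symm.measurePreserving.measure_preimage_equiv (f := L.symm.toMeasurableEquiv) A
  rw [← this]
  congr 1
  ext x
  simp [LinearIsometryEquiv.image_eq_preimage_symm]

/-- A similarity multiplies all volumes by the same positive real number. -/
theorem DilationEquiv.exists_volume_image
    (f : EuclideanSpace ℝ (Fin d) ≃ᵈ EuclideanSpace ℝ (Fin d)) :
    ∃ s : ℝ, 0 < s ∧ (∀ A, volume (f '' A) = ENNReal.ofReal (s ^ d) * volume A) ∧
      ∀ x ρ, f '' Metric.closedBall x ρ = Metric.closedBall (f x) (s * ρ) := by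
  obtain ⟨b, s, L, hs, hf⟩ := f.exists_eq_add_smul
  have hfun : (f : EuclideanSpace ℝ (Fin d) → EuclideanSpace ℝ (Fin d)) =
      fun x => b + s • L x := funext hf
  have hdist : ∀ x y, dist (f x) (f y) = s * dist x y := fun x y => by
    rw [hf, hf, dist_add_left, dist_smul₀, Real.norm_of_nonneg hs.le, L.dist_map]
  refine ⟨s, hs, fun A => by rw [hfun, volume_image_add_smul b hs], fun x ρ => ?_⟩
  ext y
  obtain ⟨z, rfl⟩ := f.surjective y
  rw [f.injective.mem_set_image, Metric.mem_closedBall, Metric.mem_closedBall, hdist,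
    mul_le_mul_iff_right₀ hs]

theorem DilationEquiv.interior_image
    (f : EuclideanSpace ℝ (Fin d) ≃ᵈ EuclideanSpace ℝ (Fin d))
    (A : Set (EuclideanSpace ℝ (Fin d))) : interior (f '' A) = f '' interior A :=
  (f.toHomeomorph.image_interior A).symm

end Dilations

/-! ### Convexity, interior and volume of hypercubes -/

section Hypercubes

variable {d : ℕ}

theorem cubeAt_eq_preimage_pi (a : Fin d → ℝ) (s : ℝ) :
    cubeAt a s = (WithLp.ofLp : EuclideanSpace ℝ (Fin d) → (Fin d → ℝ)) ⁻¹'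
      Set.Icc a (fun i => a i + s) := by
  ext x
  simp [cubeAt, Set.mem_Icc, Pi.le_def, forall_and]

theorem volume_cubeAt (a : Fin d → ℝ) {s : ℝ} (hs : 0 ≤ s) :
    volume (cubeAt a s) = ENNReal.ofReal (s ^ d) := by
  rw [cubeAt_eq_preimage_pi,
    (PiLp.volume_preserving_ofLp (Fin d)).measure_preimage measurableSet_Icc.nullMeasurableSet,
    Real.volume_Icc_pi]
  simp [ENNReal.ofReal_pow hs]

theorem unitCube_eq : unitCube d = cubeAt 0 1 := by
  ext x; simp [unitCube, cubeAt]

theorem volume_unitCube : volume (unitCube d) = 1 := by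
  rw [unitCube_eq, volume_cubeAt _ zero_le_one]; simp

theorem convex_unitCube : Convex ℝ (unitCube d) := by
  intro x hx y hy a b ha hb hab i
  have := convex_Icc (0 : ℝ) 1 (hx i) (hy i) ha hb hab
  simpa using this

theorem interior_unitCube_nonempty : (interior (unitCube d)).Nonempty := by
  have hopen : IsOpen {x : EuclideanSpace ℝ (Fin d) | ∀ i, x i ∈ Set.Ioo (0 : ℝ) 1} := by
    simp only [Set.ofPred_forall]
    exact isOpen_iInter_of_finite fun i =>
      isOpen_Ioo.preimage (EuclideanSpace.proj (𝕜 := ℝ) i).continuous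
  refine ⟨WithLp.toLp 2 fun _ => 1 / 2, interior_maximal (fun x hx i => ?_) hopen fun i => ?_⟩
  · exact Set.Ioo_subset_Icc_self (hx i)
  · norm_num

theorem isClosed_cubeAt (a : Fin d → ℝ) (s : ℝ) : IsClosed (cubeAt a s) := by
  simp only [cubeAt, Set.ofPred_forall]
  exact isClosed_iInter fun i =>
    isClosed_Icc.preimage (EuclideanSpace.proj (𝕜 := ℝ) i).continuous

theorem isHypercube_iff {A : Set (EuclideanSpace ℝ (Fin d))} :
    IsHypercube A ↔ ∃ f : EuclideanSpace ℝ (Fin d) ≃ᵈ EuclideanSpace ℝ (Fin d),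
      A = f '' unitCube d := Iff.rfl

theorem IsHypercube.image {A : Set (EuclideanSpace ℝ (Fin d))} (hA : IsHypercube A)
    (f : EuclideanSpace ℝ (Fin d) ≃ᵈ EuclideanSpace ℝ (Fin d)) : IsHypercube (f '' A) := by
  obtain ⟨g, rfl⟩ := hA
  exact ⟨g.trans f, by rw [← Set.image_comp]; rfl⟩

theorem IsHypercube.convex {A : Set (EuclideanSpace ℝ (Fin d))} (hA : IsHypercube A) :
    Convex ℝ A := by
  obtain ⟨f, rfl⟩ := isHypercube_iff.1 hA
  obtain ⟨b, s, L, -, hf⟩ := f.exists_eq_add_smul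
  rw [show (f : EuclideanSpace ℝ (Fin d) → EuclideanSpace ℝ (Fin d)) = fun x => b + s • L x from
    funext hf, image_add_smul]
  have h := ((convex_unitCube (d := d)).is_linear_image L.toLinearEquiv.toLinearMap.isLinear)
  exact (h.smul s).translate b

theorem IsHypercube.isClosed {A : Set (EuclideanSpace ℝ (Fin d))} (hA : IsHypercube A) :
    IsClosed A := by
  obtain ⟨f, rfl⟩ := isHypercube_iff.1 hA
  rw [unitCube_eq]
  exact f.toHomeomorph.isClosedMap _ (isClosed_cubeAt _ _)

theorem IsHypercube.interior_nonempty {A : Set (EuclideanSpace ℝ (Fin d))}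
    (hA : IsHypercube A) : (interior A).Nonempty := by
  obtain ⟨f, rfl⟩ := isHypercube_iff.1 hA
  rw [f.interior_image]
  exact interior_unitCube_nonempty.image _

theorem IsHypercube.closure_interior {A : Set (EuclideanSpace ℝ (Fin d))}
    (hA : IsHypercube A) : closure (interior A) = A := by
  rw [hA.convex.closure_interior_eq_closure_of_nonempty_interior hA.interior_nonempty,
    hA.isClosed.closure_eq]

/-- A hypercube meets the interior of another set only if their interiors meet. -/
theorem IsHypercube.interior_not_disjoint {A B : Set (EuclideanSpace ℝ (Fin d))}
    (hA : IsHypercube A) {x : EuclideanSpace ℝ (Fin d)} (hxA : x ∈ A) (hxB : x ∈ interior B) :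
    ¬ Disjoint (interior A) (interior B) := by
  rw [← hA.closure_interior] at hxA
  obtain ⟨y, hyB, hyA⟩ := mem_closure_iff.1 hxA _ isOpen_interior hxB
  exact Set.not_disjoint_iff.2 ⟨y, hyA, hyB⟩

/-- Any overlap lies on the two frontiers, and the frontier of a convex set is null. This makes
volumes of tiles additive. -/
theorem IsHypercube.aedisjoint {A B : Set (EuclideanSpace ℝ (Fin d))}
    (hA : IsHypercube A) (hB : IsHypercube B) (h : Disjoint (interior A) (interior B)) :
    AEDisjoint volume A B := by
  refine measure_mono_null (t := frontier A ∪ frontier B) ?_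
    (measure_union_null (hA.convex.addHaar_frontier _) (hB.convex.addHaar_frontier _))
  rintro x ⟨hxA, hxB⟩
  by_cases h1 : x ∈ interior A
  · right
    exact ⟨subset_closure hxB, fun h2 => Set.disjoint_left.1 h h1 h2⟩
  · left
    exact ⟨subset_closure hxA, h1⟩

end Hypercubes

/-! ### Recognizing axis-parallel cubes -/

section OrthonormalFrames

variable {d : ℕ}

/-- An orthonormal frame of vectors with nonnegative coordinates is a permutation of the
standard frame. -/
theorem exists_perm_of_orthonormal_nonneg (u : Fin d → EuclideanSpace ℝ (Fin d))
    (hu : Orthonormal ℝ u) (hpos : ∀ j i, 0 ≤ u j i) :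
    ∃ π : Equiv.Perm (Fin d), ∀ j, u j = EuclideanSpace.single (π j) 1 := by
  have hex : ∀ j, ∃ i, 0 < u j i := by
    intro j
    by_contra! h
    have h0 : u j = 0 := by
      ext i; exact le_antisymm (h i) (hpos j i)
    simpa [h0] using hu.1 j
  choose π hπ using hex
  -- A vanishing sum of nonnegative products has only zero terms: the supports of the frame vectors
  -- are disjoint, so `π` is injective, hence onto, and each vector keeps a single coordinate.
  have horth : ∀ j j', j ≠ j' → ∀ i, u j i * u j' i = 0 := by
    intro j j' hne
    have h : inner ℝ (u j) (u j') = 0 := hu.2 hne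
    rw [PiLp.inner_apply] at h
    intro i
    have h' := (Finset.sum_eq_zero_iff_of_nonneg (fun i _ => by
      simpa using mul_nonneg (hpos j' i) (hpos j i))).1 h i (Finset.mem_univ i)
    simpa [mul_comm] using h'
  have hinj : Function.Injective π := by
    intro j j' h
    by_contra hne
    have h1 := horth j j' hne (π j)
    have h2 := hπ j'
    rw [← h] at h2
    exact (mul_pos (hπ j) h2).ne' h1
  refine ⟨Equiv.ofBijective π (Finite.injective_iff_bijective.1 hinj), fun j => ?_⟩
  have hz : ∀ i, i ≠ π j → u j i = 0 := by
    intro i hi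
    obtain ⟨j', rfl⟩ := (Finite.injective_iff_surjective.1 hinj) i
    have hne : j ≠ j' := fun h => hi (by rw [h])
    exact (mul_eq_zero.1 (horth j j' hne (π j'))).resolve_right (hπ j').ne'
  have hsingle : u j = EuclideanSpace.single (π j) (u j (π j)) := by
    ext i
    by_cases hi : i = π j
    · subst hi; simp
    · simp [hz i hi, hi]
  have hone : u j (π j) = 1 := by
    have h := hu.1 j
    rw [hsingle, PiLp.norm_single, Real.norm_of_nonneg (hpos _ _)] at h
    exact h
  rw [hsingle, hone]
  rfl

/-- A cube that has a point whose coordinates are all minimal is axis-parallel. -/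
theorem image_unitCube_eq_cubeAt (b : EuclideanSpace ℝ (Fin d)) {s : ℝ} (hs : 0 < s)
    (L : EuclideanSpace ℝ (Fin d) ≃ₗᵢ[ℝ] EuclideanSpace ℝ (Fin d)) {p : EuclideanSpace ℝ (Fin d)}
    (hp : p ∈ (fun x => b + s • L x) '' unitCube d)
    (hmin : ∀ x ∈ (fun x => b + s • L x) '' unitCube d, ∀ i, p i ≤ x i) :
    (fun x => b + s • L x) '' unitCube d = cubeAt p s := by
  obtain ⟨t, ht, rfl⟩ := hp
  -- `σ j` is a direction in which `t` can move half an edge along axis `j` without leaving the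
  -- cube. Minimality of `p` makes the image of each such move coordinatewise nonnegative.
  set σ : Fin d → ℝ := fun j => if t j ≤ 1 / 2 then 1 else -1 with hσ
  have hσ2 : ∀ j, σ j = 1 ∨ σ j = -1 := by
    intro j
    simp only [hσ]
    split_ifs <;> simp
  have hσσ : ∀ j, σ j * σ j = 1 := by
    intro j; rcases hσ2 j with h | h <;> simp [h]
  set u : Fin d → EuclideanSpace ℝ (Fin d) := fun j => σ j • L (EuclideanSpace.single j 1) with hu
  have horth : Orthonormal ℝ u := by
    have h0 := (EuclideanSpace.basisFun (Fin d) ℝ).orthonormal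
    constructor
    · intro j
      rcases hσ2 j with h | h <;> simp [hu, h]
    · intro i j hij
      have := h0.2 hij
      simp only [EuclideanSpace.basisFun_apply] at this
      simp only [hu, inner_smul_left, inner_smul_right, L.inner_map_map, this, mul_zero]
  have hnonneg : ∀ j i, 0 ≤ u j i := by
    intro j i
    have hmem : t + (σ j / 2) • EuclideanSpace.single j 1 ∈ unitCube d := by
      intro l
      have htl := ht l
      by_cases hl : l = j
      · subst hl
        by_cases h : t l ≤ 1 / 2
        · simp only [hσ, h, if_true, PiLp.add_apply, PiLp.smul_apply, PiLp.single_apply,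
            smul_eq_mul, Set.mem_Icc]
          constructor <;> linarith [htl.1]
        · simp only [hσ, h, if_false, if_true, PiLp.add_apply, PiLp.smul_apply, PiLp.single_apply,
            smul_eq_mul, Set.mem_Icc]
          constructor <;> linarith [htl.2]
      · simpa [hl] using htl
    have h := hmin _ ⟨_, hmem, rfl⟩ i
    simp only [map_add, map_smul, PiLp.add_apply, PiLp.smul_apply, smul_eq_mul] at h
    simp only [hu, PiLp.smul_apply, smul_eq_mul]
    nlinarith
  obtain ⟨π, hπ⟩ := exists_perm_of_orthonormal_nonneg u horth hnonneg
  have hcoord : ∀ x j, (L x) (π j) = σ j * x j := by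
    intro x j
    have h1 : (L x) (π j) = inner ℝ (u j) (L x) := by
      rw [hπ j, EuclideanSpace.inner_single_left]; simp
    rw [h1]
    simp only [hu, inner_smul_left, L.inner_map_map, EuclideanSpace.inner_single_left]
    simp
  have hval : ∀ x j, (b + s • L x) (π j) = b (π j) + s * (σ j * x j) := by
    intro x j; simp [hcoord]
  -- Comparison with the vertex at which every `σ j * x j` is least shows that `t` is that vertex.
  have htv : ∀ j, t j = (1 - σ j) / 2 := by
    intro j
    let x : EuclideanSpace ℝ (Fin d) := WithLp.toLp 2 fun j => (1 - σ j) / 2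
    have hx : x ∈ unitCube d := by
      intro l
      rcases hσ2 l with h | h <;> simp [x, h]
    have h := hmin _ ⟨x, hx, rfl⟩ (π j)
    simp only [hval] at h
    have h' : σ j * t j ≤ σ j * x j := by nlinarith
    have hx' : x j = (1 - σ j) / 2 := rfl
    rw [hx'] at h'
    have htj := ht j
    rcases hσ2 j with e | e <;> rw [e] at h' ⊢ <;> [linarith [htj.1]; linarith [htj.2]]
  ext y
  constructor
  · rintro ⟨x, hx, rfl⟩ i
    obtain ⟨j, rfl⟩ := π.surjective i
    have hxj := hx j
    simp only [hval, htv, Set.mem_Icc]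
    rcases hσ2 j with e | e <;> rw [e] <;> constructor <;> nlinarith [hxj.1, hxj.2]
  · intro hy
    refine ⟨WithLp.toLp 2 fun j => σ j * ((y (π j) - b (π j)) / s), fun j => ?_, ?_⟩
    · have h := hy (π j)
      simp only [hval, htv, Set.mem_Icc] at h
      have e1 : y (π j) - b (π j) = s * ((y (π j) - b (π j)) / s) := by field_simp
      set w := (y (π j) - b (π j)) / s
      change σ j * w ∈ Set.Icc (0 : ℝ) 1
      rcases hσ2 j with e | e <;> rw [e] at h ⊢ <;>
        constructor <;> by_contra! hc <;> nlinarith [h.1, h.2]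
    · ext i
      obtain ⟨j, rfl⟩ := π.surjective i
      rw [hval]
      simp only
      rw [← mul_assoc (σ j), hσσ, one_mul]
      field_simp
      ring

end OrthonormalFrames

/-! ### Dissections of a cube into congruent cubes -/

section GridDissection

variable {d : ℕ}

theorem IsHypercube.exists_eq_image_of_volume (hd : d ≠ 0) {A : Set (EuclideanSpace ℝ (Fin d))}
    (hA : IsHypercube A) {s : ℝ} (hs : 0 < s) (hvol : volume A = ENNReal.ofReal (s ^ d)) :
    ∃ (b : EuclideanSpace ℝ (Fin d)) (L : EuclideanSpace ℝ (Fin d) ≃ₗᵢ[ℝ] EuclideanSpace ℝ (Fin d)),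
      A = (fun x => b + s • L x) '' unitCube d := by
  obtain ⟨f, rfl⟩ := isHypercube_iff.1 hA
  obtain ⟨b, s', L, hs', hf⟩ := f.exists_eq_add_smul
  rw [show (f : EuclideanSpace ℝ (Fin d) → EuclideanSpace ℝ (Fin d)) = fun x => b + s' • L x from
    funext hf] at hvol ⊢
  rw [volume_image_add_smul b hs', volume_unitCube, mul_one,
    ENNReal.ofReal_eq_ofReal_iff (pow_pos hs' d).le (pow_pos hs d).le,
    pow_left_inj₀ hs'.le hs.le hd] at hvol
  exact ⟨b, L, by rw [hvol]⟩

/-- Used to conclude that a tile containing points close enough to `p` contains `p` itself. -/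
theorem Filter.eventually_forall_notMem_of_isClosed {X ι : Type*} [TopologicalSpace X] [Finite ι]
    {C : ι → Set X} (hC : ∀ i, IsClosed (C i)) (p : X) :
    ∀ᶠ x in nhds p, ∀ i, p ∉ C i → x ∉ C i := by
  rw [Filter.eventually_all]
  intro i
  by_cases hp : p ∈ C i
  · exact Filter.Eventually.of_forall fun x h => absurd hp h
  · filter_upwards [(hC i).isOpen_compl.mem_nhds hp] with x hx _ using hx

/-- In a dissection of the unit cube into congruent hypercubes, the tiles form a grid. -/
theorem exists_eq_gridCell {ι : Type*} [Finite ι] (hd : d ≠ 0)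
    {C : ι → Set (EuclideanSpace ℝ (Fin d))} {s : ℝ} (hs : 0 < s)
    (hC : ∀ i, IsHypercube (C i)) (hvol : ∀ i, volume (C i) = ENNReal.ofReal (s ^ d))
    (hdisj : ∀ i j, i ≠ j → Disjoint (interior (C i)) (interior (C j)))
    (hU : ⋃ i, C i = unitCube d) (z : Fin d → ℕ) (hz : ∀ j, s * z j < 1) :
    ∃ i, C i = gridCell s z := by
  have hinj : ∀ i j x, x ∈ C i → x ∈ interior (C j) → i = j := fun i j x hi hj => by
    by_contra hne
    exact (hC i).interior_not_disjoint hi hj (hdisj i j hne)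
  have hsub : ∀ i, C i ⊆ unitCube d := fun i => hU ▸ Set.subset_iUnion C i
  -- Induction in the product order: all cells with a smaller index are already known to be tiles.
  induction z using WellFoundedLT.induction with
  | ind z ih =>
  set p : EuclideanSpace ℝ (Fin d) := WithLp.toLp 2 fun j => s * z j with hp
  have hpj : ∀ j, p j = s * z j := fun j => rfl
  have hp0 : ∀ j, 0 ≤ p j := fun j => by rw [hpj]; positivity
  -- a tile at `p` that contains a point `q` strictly above `p` in all coordinates
  obtain ⟨i, q, hpi, hqi, hpq⟩ : ∃ i, ∃ q : EuclideanSpace ℝ (Fin d),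
      p ∈ C i ∧ q ∈ C i ∧ ∀ j, p j < q j := by
    let g : ℝ → EuclideanSpace ℝ (Fin d) := fun ε => p + ε • WithLp.toLp 2 fun _ => 1
    have hgj : ∀ ε j, g ε j = p j + ε := fun ε j => by simp [g]
    have hg : Filter.Tendsto g (nhdsWithin 0 (Set.Ioi 0)) (nhds p) := by
      have hcont : Continuous g := by fun_prop
      have := hcont.tendsto 0
      simp only [g, zero_smul, add_zero] at this
      exact this.mono_left nhdsWithin_le_nhds
    have h1 := hg.eventually
      (Filter.eventually_forall_notMem_of_isClosed (fun i => (hC i).isClosed) p)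
    have h2 : ∀ᶠ ε : ℝ in nhdsWithin 0 (Set.Ioi 0), ∀ j, p j + ε < 1 := by
      rw [Filter.eventually_all]
      intro j
      have : ∀ᶠ ε : ℝ in nhds 0, ε < 1 - p j :=
        Iio_mem_nhds (by have := hz j; rw [hpj]; linarith)
      filter_upwards [this.filter_mono nhdsWithin_le_nhds] with ε hε
      linarith
    obtain ⟨ε, ⟨h1, h2⟩, hε⟩ := ((h1.and h2).and self_mem_nhdsWithin).exists
    have hε : 0 < ε := hε
    have hmem : g ε ∈ unitCube d := fun j => by
      rw [hgj]; exact ⟨by linarith [hp0 j], (h2 j).le⟩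
    rw [← hU] at hmem
    obtain ⟨i, hi⟩ := Set.mem_iUnion.1 hmem
    refine ⟨i, g ε, ?_, hi, fun j => by rw [hgj]; linarith⟩
    by_contra hpi
    exact h1 i hpi hi
  -- If `x` falls below `p` in some coordinates, lowering exactly these indices by one gives a
  -- smaller cell containing `x`. By induction it is a tile, so it is `C i`; but it ends at `p j₀`,
  -- whereas `q` in `C i` exceeds `p j₀`.
  have hnear : ∀ x ∈ interior (C i), (∀ j, p j - s < x j ∧ x j < p j + s) → ∀ j, p j ≤ x j := by
    intro x hx hxs j₀
    by_contra! hj₀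
    have hxU := hsub i (interior_subset hx)
    have hzpos : ∀ j, x j < p j → 1 ≤ z j := by
      intro j hj
      by_contra! h0
      have h0 : z j = 0 := by omega
      rw [hpj, h0] at hj
      have := (hxU j).1
      simp at hj
      linarith
    set z' : Fin d → ℕ := fun j => if x j < p j then z j - 1 else z j with hz'
    have hle : z' ≤ z := fun j => by
      simp only [hz']; split_ifs <;> omega
    have hlt : z' < z := by
      refine Pi.lt_def.2 ⟨hle, j₀, ?_⟩
      have := hzpos j₀ hj₀
      simp only [hz', hj₀, if_true]; omega
    obtain ⟨i', hi'⟩ := ih z' hlt fun j => by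
      have h1 : (z' j : ℝ) ≤ z j := by exact_mod_cast hle j
      nlinarith [hz j]
    have hcast : ∀ j, x j < p j → s * (z' j : ℝ) = p j - s := by
      intro j hj
      have e : z' j = z j - 1 := if_pos hj
      rw [e, hpj, Nat.cast_sub (hzpos j hj)]
      push_cast; ring
    have hxi' : x ∈ C i' := by
      rw [hi']
      intro j
      by_cases hj : x j < p j
      · change s * (z' j : ℝ) ≤ x j ∧ x j ≤ s * (z' j : ℝ) + s
        rw [hcast j hj]
        constructor <;> linarith [(hxs j).1]
      · have : z' j = z j := by simp [hz', hj]
        change s * (z' j : ℝ) ≤ x j ∧ x j ≤ s * (z' j : ℝ) + s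
        rw [this, ← hpj]
        exact ⟨not_lt.1 hj, (hxs j).2.le⟩
    have hii := hinj i' i x hxi' hx
    rw [← hii, hi'] at hqi
    have h := (hqi j₀).2
    change q j₀ ≤ s * (z' j₀ : ℝ) + s at h
    rw [hcast j₀ hj₀] at h
    linarith [hpq j₀]
  -- By convexity a violating point can be pulled towards `p` until it is within range of `hnear`,
  -- and then moved slightly into the interior.
  have hmin : ∀ x ∈ C i, ∀ j, p j ≤ x j := by
    intro x hx j₀
    by_contra! hj₀
    let g : ℝ → EuclideanSpace ℝ (Fin d) := fun t => p + t • (x - p)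
    have hgj : ∀ t j, g t j = p j + t * (x j - p j) := fun t j => by simp [g]
    have hopen : IsOpen {y : EuclideanSpace ℝ (Fin d) | ∀ j, p j - s < y j ∧ y j < p j + s} := by
      simp only [Set.ofPred_forall]
      exact isOpen_iInter_of_finite fun j =>
        isOpen_Ioo.preimage (EuclideanSpace.proj (𝕜 := ℝ) j).continuous
    have hg : Filter.Tendsto g (nhdsWithin 0 (Set.Ioi 0)) (nhds p) := by
      have hcont : Continuous g := by fun_prop
      have := hcont.tendsto 0
      simp only [g, zero_smul, add_zero] at this
      exact this.mono_left nhdsWithin_le_nhds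
    have h1 := hg.eventually (hopen.mem_nhds (x := p) fun j => ⟨by linarith, by linarith⟩)
    have h2 : ∀ᶠ t : ℝ in nhdsWithin 0 (Set.Ioi 0), t < 1 :=
      Filter.Eventually.filter_mono nhdsWithin_le_nhds (Iio_mem_nhds one_pos)
    obtain ⟨t, ⟨h1, h2⟩, h3⟩ := ((h1.and h2).and self_mem_nhdsWithin).exists
    have h3 : 0 < t := h3
    have hgt : g t ∈ C i := (hC i).convex.add_smul_sub_mem hpi hx ⟨h3.le, h2.le⟩
    have hopen' : IsOpen ({y : EuclideanSpace ℝ (Fin d) | ∀ j, p j - s < y j ∧ y j < p j + s} ∩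
        {y | y j₀ < p j₀}) :=
      hopen.inter (isOpen_Iio.preimage (EuclideanSpace.proj (𝕜 := ℝ) j₀).continuous)
    rw [← (hC i).closure_interior] at hgt
    obtain ⟨y, ⟨hy1, hy2⟩, hy3⟩ := mem_closure_iff.1 hgt _ hopen' ⟨h1, by
      change g t j₀ < p j₀
      rw [hgj]; nlinarith⟩
    exact absurd (hnear y hy3 hy1 j₀) (not_le.2 hy2)
  obtain ⟨b, L, hb⟩ := (hC i).exists_eq_image_of_volume hd hs (hvol i)
  refine ⟨i, ?_⟩
  rw [hb] at hpi hmin ⊢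
  exact image_unitCube_eq_cubeAt b hs L hpi hmin

theorem mem_gridCell_iff {s : ℝ} {z : Fin d → ℕ} {x : EuclideanSpace ℝ (Fin d)} :
    x ∈ gridCell s z ↔ ∀ j, s * z j ≤ x j ∧ x j ≤ s * z j + s := Iff.rfl

/-- The number of tiles along an edge is an integer `m`, and the tiles are exactly the `m ^ d`
cells of the grid. -/
theorem exists_grid {ι : Type*} [Finite ι] (hd : d ≠ 0)
    {C : ι → Set (EuclideanSpace ℝ (Fin d))} {s : ℝ} (hs : 0 < s)
    (hC : ∀ i, IsHypercube (C i)) (hvol : ∀ i, volume (C i) = ENNReal.ofReal (s ^ d))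
    (hdisj : ∀ i j, i ≠ j → Disjoint (interior (C i)) (interior (C j)))
    (hU : ⋃ i, C i = unitCube d) :
    ∃ m : ℕ, s * m = 1 ∧ (∀ z : Fin d → ℕ, (∀ j, z j < m) → ∃ i, C i = gridCell s z) ∧
      ∀ i, ∃ z : Fin d → ℕ, (∀ j, z j < m) ∧ C i = gridCell s z := by
  have hgrid := exists_eq_gridCell hd hs hC hvol hdisj hU
  have hsub : ∀ i, C i ⊆ unitCube d := fun i => hU ▸ Set.subset_iUnion C i
  -- The cell of the last grid corner below 1 is a tile, so it cannot protrude from the unit cube: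
  -- its upper end is exactly 1.
  obtain ⟨m, hm⟩ : ∃ m : ℕ, s * m = 1 := by
    have hpos : 0 < 1 / s := by positivity
    obtain ⟨k, hk⟩ : ∃ k, ⌈1 / s⌉₊ = k + 1 :=
      Nat.exists_eq_succ_of_ne_zero (Nat.ceil_pos.2 hpos).ne'
    have hk1 : s * k < 1 := by
      have : (k : ℝ) < 1 / s := Nat.lt_ceil.1 (by omega)
      rw [lt_div_iff₀ hs] at this; linarith
    have hk2 : 1 ≤ s * (k + 1) := by
      have := Nat.le_ceil (1 / s)
      rw [hk, div_le_iff₀ hs] at this; push_cast at this; linarith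
    obtain ⟨i, hi⟩ := hgrid (fun _ => k) fun _ => hk1
    have hmem : (WithLp.toLp 2 fun _ => s * k + s : EuclideanSpace ℝ (Fin d)) ∈ C i := by
      rw [hi, mem_gridCell_iff]
      exact fun j => ⟨by simpa using hs.le, le_rfl⟩
    have := (hsub i hmem ⟨0, Nat.pos_of_ne_zero hd⟩).2
    refine ⟨k + 1, le_antisymm ?_ (by push_cast; exact hk2)⟩
    push_cast; simp only at this; linarith
  have hm0 : m ≠ 0 := by rintro rfl; simp at hm
  have hlt : ∀ k : ℕ, k < m → s * k < 1 := fun k hk => by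
    rw [← hm]; exact mul_lt_mul_of_pos_left (by exact_mod_cast hk) hs
  refine ⟨m, hm, fun z hz => hgrid z fun j => hlt _ (hz j), fun i => ?_⟩
  obtain ⟨x, hx⟩ := (hC i).interior_nonempty
  have hxU := hsub i (interior_subset hx)
  -- The cap assigns coordinate 1 to the last cell, since cells are closed.
  set z : Fin d → ℕ := fun j => min ⌊x j / s⌋₊ (m - 1) with hz
  have hzm : ∀ j, z j < m := fun j => by simp only [hz]; omega
  obtain ⟨i', hi'⟩ := hgrid z fun j => hlt _ (hzm j)
  have hxi' : x ∈ C i' := by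
    rw [hi', mem_gridCell_iff]
    intro j
    have h0 : 0 ≤ x j / s := div_nonneg (hxU j).1 hs.le
    have h1 := Nat.floor_le h0
    have h2 := (Nat.lt_floor_add_one (x j / s)).le
    rw [le_div_iff₀ hs] at h1
    rw [div_le_iff₀ hs] at h2
    constructor
    · have : (z j : ℝ) ≤ (⌊x j / s⌋₊ : ℝ) := by exact_mod_cast min_le_left _ _
      nlinarith
    · rcases min_choice ⌊x j / s⌋₊ (m - 1) with e | e
      · simp only [hz, e]; linarith
      · simp only [hz, e]
        rw [Nat.cast_sub (by omega)]
        push_cast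
        linarith [(hxU j).2]
  have : i' = i := by
    by_contra hne
    exact (hC i').interior_not_disjoint hxi' hx (hdisj i' i hne)
  exact ⟨z, hzm, this ▸ hi'⟩

end GridDissection

/-! ### Indexing tiles by their position in scanning order -/

theorem List.range_mul (a b : ℕ) :
    List.range (a * b) = (List.range a).flatMap fun q => (List.range b).map fun j => q * b + j := by
  induction a with
  | zero => simp
  | succ a ih => rw [Nat.succ_mul, List.range_add, ih, List.range_succ, List.flatMap_append]; simp

theorem List.reverse_map_range {α : Type*} (g : ℕ → α) (N : ℕ) :
    ((List.range N).map g).reverse = (List.range N).map fun j => g (N - 1 - j) := by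
  refine List.ext_getElem (by simp) fun i h1 h2 => ?_
  simp

namespace ScanningOrder

variable {d : ℕ} {T : RecursiveTiling d}

/-- The index of the tile of rule `r` in position `q`, where positions are read modulo the number
of tiles. -/
def idx (S : ScanningOrder T) (r : T.Rule) (q : ℕ) : Fin (T.size r) :=
  S.order r ⟨q % T.size r, Nat.mod_lt _ (by have := T.two_le_size r; omega)⟩

/-- The tile in position `p` among the `n ^ k` tiles at depth `k`, if every rule has `n` tiles. -/
def tile (S : ScanningOrder T) (n : ℕ) : ℕ → T.Rule → ℕ → Set (EuclideanSpace ℝ (Fin d))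
  | 0, r, _ => T.region r
  | k + 1, r, p =>
      T.place r (S.idx r (p / n ^ k)) '' S.tile n k (T.child r (S.idx r (p / n ^ k)))
        (if S.reversed r (S.idx r (p / n ^ k)) then n ^ k - 1 - p % n ^ k else p % n ^ k)

variable {S : ScanningOrder T} {n : ℕ}

theorem two_le_of_size_eq (h : ∀ r, T.size r = n) : 2 ≤ n := h T.root ▸ T.two_le_size T.root

theorem idx_surjective (h : ∀ r, T.size r = n) (r : T.Rule) (i : Fin (T.size r)) :
    ∃ q < n, S.idx r q = i := by
  refine ⟨((S.order r).symm i : ℕ), h r ▸ ((S.order r).symm i).2, ?_⟩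
  simp [idx, Nat.mod_eq_of_lt]

theorem idx_injective (h : ∀ r, T.size r = n) (r : T.Rule) {q q' : ℕ} (hq : q < n) (hq' : q' < n)
    (he : S.idx r q = S.idx r q') : q = q' := by
  have := (S.order r).injective he
  simpa [h r, Nat.mod_eq_of_lt hq, Nat.mod_eq_of_lt hq'] using this

theorem reverse_index_lt {N : ℕ} (hN : 0 < N) (c : Bool) (p : ℕ) :
    (if c then N - 1 - p % N else p % N) < N := by
  have := Nat.mod_lt p hN
  split_ifs <;> omega

/-- Turns the recursive lists into arithmetic: the leading base-`n` digit of a position selects the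
top-level tile, and reversal complements the remaining digits. -/
theorem scan_eq_map_tile (h : ∀ r, T.size r = n) (k : ℕ) (r : T.Rule) :
    S.scan k r = (List.range (n ^ k)).map (S.tile n k r) := by
  have hn := two_le_of_size_eq h
  induction k generalizing r with
  | zero => simp [scan, tile]
  | succ k ih =>
    have hN : 0 < n ^ k := by positivity
    have hrange : List.range n = (List.finRange (T.size r)).map Fin.val := by
      rw [List.map_coe_finRange_eq_range, h r]
    rw [scan, pow_succ', List.range_mul, List.map_flatMap, hrange, List.flatMap_map]
    congr 1
    funext q
    have hq : S.idx r q = S.order r q := by simp [idx, Nat.mod_eq_of_lt]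
    rw [List.map_map]
    have key : ∀ j, j < n ^ k → S.tile n (k + 1) r (q * n ^ k + j) =
        T.place r (S.order r q) '' S.tile n k (T.child r (S.order r q))
          (if S.reversed r (S.order r q) then n ^ k - 1 - j else j) := by
      intro j hj
      have e1 : (q * n ^ k + j) / n ^ k = q := by
        rw [mul_comm, Nat.mul_add_div hN, Nat.div_eq_of_lt hj, add_zero]
      have e2 : (q * n ^ k + j) % n ^ k = j := by
        rw [mul_comm, Nat.mul_add_mod, Nat.mod_eq_of_lt hj]
      rw [tile, e1, e2, hq]
    simp only [ih, List.map_map]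
    by_cases hrev : S.reversed r (S.order r q)
    · simp only [hrev, if_true, List.reverse_map_range]
      refine List.map_congr_left fun j hj => ?_
      simp only [Function.comp_apply, key j (List.mem_range.1 hj), hrev, if_true]
    · simp only [hrev]
      refine List.map_congr_left fun j hj => ?_
      simp only [Function.comp_apply, key j (List.mem_range.1 hj), hrev]
      rfl

/-- Permuting and reversing change only the order. Hence any scanning order may be used to index the
tiles of a bare tiling. -/
theorem mem_tilesAt_iff_mem_scan (k : ℕ) (r : T.Rule) (A : Set (EuclideanSpace ℝ (Fin d))) :
    A ∈ T.tilesAt k r ↔ A ∈ S.scan k r := by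
  induction k generalizing r A with
  | zero => simp [RecursiveTiling.tilesAt, scan]
  | succ k ih =>
    have hmem : ∀ p : Fin (T.size r), (A ∈ (
        let i := S.order r p
        let L := (S.scan k (T.child r i)).map fun A => T.place r i '' A
        if S.reversed r i then L.reverse else L)) ↔
        ∃ B ∈ T.tilesAt k (T.child r (S.order r p)), A = T.place r (S.order r p) '' B := by
      intro p
      simp only [ih]
      split_ifs <;> simp [eq_comm]
    simp only [scan, List.mem_flatMap, List.mem_finRange, true_and]
    simp only [hmem]
    constructor
    · rintro ⟨i, B, hB, rfl⟩
      obtain ⟨q, rfl⟩ := (S.order r).surjective i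
      exact ⟨q, B, hB, rfl⟩
    · rintro ⟨q, B, hB, rfl⟩
      exact ⟨_, B, hB, rfl⟩

theorem tile_subset_region (k : ℕ) (r : T.Rule) (p : ℕ) :
    S.tile n k r p ⊆ T.region r := by
  induction k generalizing r p with
  | zero => exact subset_rfl
  | succ k ih =>
    rw [tile, T.region_eq r]
    exact (Set.image_mono (ih _ _)).trans
      (Set.subset_iUnion (fun i => T.place r i '' T.region (T.child r i)) _)

/-- Reversal maps a block of `n` sibling positions onto another such block with its members flipped,
so siblings stay consecutive at every depth. -/
theorem tile_eq_iUnion (h : ∀ r, T.size r = n) (k : ℕ) (r : T.Rule) {p : ℕ} (hp : p < n ^ k) :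
    S.tile n k r p = ⋃ c : Fin n, S.tile n (k + 1) r (p * n + c) := by
  have hn := two_le_of_size_eq h
  induction k generalizing r p with
  | zero =>
    obtain rfl : p = 0 := by simpa using hp
    rw [tile, T.region_eq r]
    ext x
    simp only [Set.mem_iUnion, tile, zero_mul, zero_add, pow_zero, Nat.div_one]
    constructor
    · rintro ⟨i, hi⟩
      obtain ⟨q, hq, rfl⟩ := idx_surjective (S := S) h r i
      exact ⟨⟨q, hq⟩, hi⟩
    · rintro ⟨c, hc⟩
      exact ⟨_, hc⟩
  | succ k ih =>
    have hN : 0 < n ^ k := by positivity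
    have hr := Nat.mod_lt p hN
    have e1 : ∀ c : Fin n, (p * n + c) / n ^ (k + 1) = p / n ^ k := fun c => by
      rw [pow_succ', ← Nat.div_div_eq_div_mul, mul_comm p n, Nat.mul_add_div (by omega),
        Nat.div_eq_of_lt c.2, add_zero]
    have e2 : ∀ c : Fin n, (p * n + c) % n ^ (k + 1) = p % n ^ k * n + c := fun c => by
      have hlt : p % n ^ k * n + c < n ^ (k + 1) := by
        rw [pow_succ]
        calc p % n ^ k * n + c < p % n ^ k * n + n := by have := c.2; omega
          _ = (p % n ^ k + 1) * n := by ring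
          _ ≤ n ^ k * n := Nat.mul_le_mul_right _ hr
      have : p * n + c = n ^ (k + 1) * (p / n ^ k) + (p % n ^ k * n + c) := by
        conv_lhs => rw [← Nat.div_add_mod p (n ^ k)]
        ring
      rw [this, Nat.mul_add_mod, Nat.mod_eq_of_lt hlt]
    rw [tile, ih _ (reverse_index_lt hN _ _), Set.image_iUnion]
    by_cases hrev : S.reversed r (S.idx r (p / n ^ k))
    -- Complementing a position complements its block number and its last digit separately.
    · have e3 : ∀ c : Fin n, n ^ (k + 1) - 1 - (p % n ^ k * n + c) =
          (n ^ k - 1 - p % n ^ k) * n + (Fin.rev c : Fin n) := fun c => by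
        have hc := c.2
        obtain ⟨t, ht⟩ : ∃ t, n ^ k = p % n ^ k + 1 + t := ⟨_, (Nat.add_sub_of_le hr).symm⟩
        have h1 : n ^ k - 1 - p % n ^ k = t := by omega
        have h2 : n ^ (k + 1) = p % n ^ k * n + n + t * n := by rw [pow_succ]; nlinarith
        rw [h1, h2, Fin.val_rev]
        omega
      have e4 : ∀ c : Fin n, S.tile n (k + 1 + 1) r (p * n + c) =
          T.place r (S.idx r (p / n ^ k)) '' S.tile n (k + 1) (T.child r (S.idx r (p / n ^ k)))
            ((n ^ k - 1 - p % n ^ k) * n + (Fin.rev c : Fin n)) := fun c => by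
        rw [tile, e1, e2, if_pos hrev, e3]
      simp only [e4, hrev, if_true]
      exact (Fin.revPerm.iSup_comp (g := fun c : Fin n => T.place r (S.idx r (p / n ^ k)) ''
        S.tile n (k + 1) (T.child r (S.idx r (p / n ^ k)))
            ((n ^ k - 1 - p % n ^ k) * n + c))).symm
    · have e4 : ∀ c : Fin n, S.tile n (k + 1 + 1) r (p * n + c) =
          T.place r (S.idx r (p / n ^ k)) '' S.tile n (k + 1) (T.child r (S.idx r (p / n ^ k)))
            (p % n ^ k * n + c) := fun c => by
        rw [tile, e1, e2, if_neg hrev]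
      simp only [e4, hrev]
      rfl

theorem disjoint_interior_tile (h : ∀ r, T.size r = n) (k : ℕ) (r : T.Rule) {p p' : ℕ}
    (hp : p < n ^ k) (hp' : p' < n ^ k) (hne : p ≠ p') :
    Disjoint (interior (S.tile n k r p)) (interior (S.tile n k r p')) := by
  have hn := two_le_of_size_eq h
  induction k generalizing r p p' with
  | zero => simp at hp hp'; omega
  | succ k ih =>
    have hN : 0 < n ^ k := by positivity
    have hd : ∀ q, q < n ^ (k + 1) → q / n ^ k < n := fun q hq => by
      rw [Nat.div_lt_iff_lt_mul hN, ← pow_succ']; exact hq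
    by_cases hq : p / n ^ k = p' / n ^ k
    · have hmod : p % n ^ k ≠ p' % n ^ k := fun hm => hne (by
        rw [← Nat.div_add_mod p (n ^ k), ← Nat.div_add_mod p' (n ^ k), hq, hm])
      rw [tile, tile, ← hq, DilationEquiv.interior_image, DilationEquiv.interior_image,
        Set.disjoint_image_iff (DilationEquiv.injective _)]
      refine ih _ (reverse_index_lt hN _ _) (reverse_index_lt hN _ _) ?_
      have h1 := Nat.mod_lt p hN
      have h2 := Nat.mod_lt p' hN
      split_ifs <;> omega
    · have hi : S.idx r (p / n ^ k) ≠ S.idx r (p' / n ^ k) := fun he =>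
        hq (idx_injective h r (hd p hp) (hd p' hp') he)
      refine (T.disjoint_interior r _ _ hi).mono ?_ ?_ <;>
      · rw [tile]
        exact interior_mono (Set.image_mono (tile_subset_region _ _ _))

theorem isHypercube_tile (hT : ∀ r, IsHypercube (T.region r)) (k : ℕ) (r : T.Rule) (p : ℕ) :
    IsHypercube (S.tile n k r p) := by
  induction k generalizing r p with
  | zero => exact hT r
  | succ k ih => exact (ih _ _).image _

theorem volume_place_region (h : ∀ r, T.size r = n) (hT : T.IsUniformHypercubeTiling)
    (r : T.Rule) (i : Fin (T.size r)) :
    (n : ℝ≥0∞) * volume (T.place r i '' T.region (T.child r i)) = volume (T.region r) := by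
  have hcube : ∀ j, IsHypercube (T.place r j '' T.region (T.child r j)) := fun j =>
    (hT.2 _).image _
  conv_rhs => rw [T.region_eq r]
  rw [measure_iUnion₀ (fun j j' hj => (hcube j).aedisjoint (hcube j')
      (T.disjoint_interior r j j' hj)) fun j => (hcube j).isClosed.measurableSet.nullMeasurableSet,
    tsum_fintype, Finset.sum_congr rfl fun j _ => hT.1.2.2 r j i]
  simp [h r]

theorem volume_tile (h : ∀ r, T.size r = n) (hT : T.IsUniformHypercubeTiling) (k : ℕ)
    (r : T.Rule) (p : ℕ) :
    (n : ℝ≥0∞) ^ k * volume (S.tile n k r p) = volume (T.region r) := by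
  induction k generalizing r p with
  | zero => simp [tile]
  | succ k ih =>
    obtain ⟨s, -, hs, -⟩ := (T.place r (S.idx r (p / n ^ k))).exists_volume_image
    rw [tile, hs, ← volume_place_region h hT r (S.idx r (p / n ^ k)), hs, ← ih]
    ring

end ScanningOrder

/-! ### Nested dissections of the unit cube -/

/-- A family of nested dissections of the unit cube: `G k p`, for `p < n ^ k`, are the tiles at
depth `k`, which are congruent hypercubes, and the tile `G k p` is dissected into the `n` tiles
`G (k + 1) (p * n + c)`. -/
structure CubeRefinement (d n : ℕ) (G : ℕ → ℕ → Set (EuclideanSpace ℝ (Fin d))) : Prop where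
  two_le : 2 ≤ n
  zero : G 0 0 = unitCube d
  subdivide : ∀ k p, p < n ^ k → G k p = ⋃ c : Fin n, G (k + 1) (p * n + c)
  disjoint : ∀ k p p', p < n ^ k → p' < n ^ k → p ≠ p' →
    Disjoint (interior (G k p)) (interior (G k p'))
  isHypercube : ∀ k p, IsHypercube (G k p)
  volume_eq : ∀ k p, (n : ℝ≥0∞) ^ k * volume (G k p) = 1

namespace CubeRefinement

variable {d n : ℕ} {G : ℕ → ℕ → Set (EuclideanSpace ℝ (Fin d))}

/-- Going up `h` levels drops the last `h` base-`n` digits. -/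
theorem subset_ancestor (R : CubeRefinement d n G) (k h : ℕ) {p : ℕ} (hp : p < n ^ (k + h)) :
    G (k + h) p ⊆ G k (p / n ^ h) := by
  have hn := R.two_le
  induction h generalizing p with
  | zero => simp
  | succ h ih =>
    have hp' : p / n < n ^ (k + h) := by
      rw [Nat.div_lt_iff_lt_mul (by omega), ← pow_succ]; exact hp
    have h1 := ih hp'
    rw [Nat.div_div_eq_div_mul, ← pow_succ', R.subdivide _ _ hp'] at h1
    refine subset_trans ?_ h1
    have h2 := Set.subset_iUnion (fun c : Fin n => G (k + h + 1) (p / n * n + c))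
      ⟨p % n, Nat.mod_lt _ (by omega)⟩
    simp only [Nat.div_add_mod'] at h2
    exact h2

theorem subset_descendants (R : CubeRefinement d n G) (k h : ℕ) {q : ℕ} (hq : q < n ^ k)
    {x : EuclideanSpace ℝ (Fin d)} (hx : x ∈ G k q) :
    ∃ p, q * n ^ h ≤ p ∧ p < (q + 1) * n ^ h ∧ x ∈ G (k + h) p := by
  induction h with
  | zero => exact ⟨q, by simp, by simp, hx⟩
  | succ h ih =>
    obtain ⟨p, h1, h2, h3⟩ := ih
    have hp : p < n ^ (k + h) := by
      rw [pow_add]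
      exact h2.trans_le (Nat.mul_le_mul_right _ hq)
    rw [R.subdivide _ _ hp] at h3
    obtain ⟨c, hc⟩ := Set.mem_iUnion.1 h3
    refine ⟨p * n + c, ?_, ?_, hc⟩
    · rw [pow_succ, ← mul_assoc]
      exact (Nat.mul_le_mul_right n h1).trans (Nat.le_add_right _ _)
    · rw [pow_succ, ← mul_assoc]
      calc p * n + c < p * n + n := by have := c.2; omega
        _ = (p + 1) * n := by ring
        _ ≤ _ := Nat.mul_le_mul_right n h2

theorem iUnion_eq (R : CubeRefinement d n G) (k : ℕ) :
    ⋃ p : Fin (n ^ k), G k p = unitCube d := by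
  refine subset_antisymm (Set.iUnion_subset fun p => ?_) fun x hx => ?_
  · have h := R.subset_ancestor 0 k (p := p) (by simp)
    rwa [zero_add, Nat.div_eq_of_lt p.2, R.zero] at h
  · rw [← R.zero] at hx
    obtain ⟨p, -, h2, h3⟩ := R.subset_descendants 0 k (q := 0) (by simp) hx
    rw [zero_add] at h3
    exact Set.mem_iUnion.2 ⟨⟨p, by simpa using h2⟩, h3⟩

theorem ancestor_eq (R : CubeRefinement d n G) {k h p q : ℕ} (hp : p < n ^ (k + h))
    (hq : q < n ^ k) {x : EuclideanSpace ℝ (Fin d)} (hx : x ∈ G (k + h) p)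
    (hxq : x ∈ interior (G k q)) : p / n ^ h = q := by
  have hn := R.two_le
  by_contra hne
  refine (R.isHypercube k _).interior_not_disjoint (R.subset_ancestor k h hp hx) hxq
    (R.disjoint k _ _ ?_ hq hne)
  rwa [Nat.div_lt_iff_lt_mul (by positivity), ← pow_add]

/-- A set of volume less than that of the tiles at depth `J` contains no tile at depth `J` or
less. -/
theorem lt_of_subset_of_volume_lt (R : CubeRefinement d n G) {A : Set (EuclideanSpace ℝ (Fin d))}
    {J k p : ℕ} (hA : (n : ℝ≥0∞) ^ J * volume A < 1) (hsub : G k p ⊆ A) : J < k := by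
  by_contra! h
  refine hA.not_ge ?_
  rw [← R.volume_eq k p]
  gcongr
  exact_mod_cast (by have := R.two_le; omega : 1 ≤ n)

/-- Each depth is a grid with some integer `M` of cells per edge, and counting volume gives `M ^ d =
n ^ k`. Depth 1 defines `m`; injectivity of the `d`-th power then gives `M = m ^ k`. -/
theorem exists_mesh (R : CubeRefinement d n G) (hd : d ≠ 0) :
    ∃ m : ℕ, 2 ≤ m ∧ m ^ d = n ∧ ∀ k,
      (∀ z : Fin d → ℕ, (∀ j, z j < m ^ k) → ∃ p < n ^ k, G k p = gridCell ((m : ℝ) ^ k)⁻¹ z) ∧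
      ∀ p < n ^ k, ∃ z : Fin d → ℕ, (∀ j, z j < m ^ k) ∧ G k p = gridCell ((m : ℝ) ^ k)⁻¹ z := by
  have hn := R.two_le
  have hn0 : (0 : ℝ) < n := by exact_mod_cast (by omega : 0 < n)
  have key : ∀ k, ∃ M : ℕ, M ^ d = n ^ k ∧
      (∀ z : Fin d → ℕ, (∀ j, z j < M) → ∃ p < n ^ k, G k p = gridCell (M : ℝ)⁻¹ z) ∧
      ∀ p < n ^ k, ∃ z : Fin d → ℕ, (∀ j, z j < M) ∧ G k p = gridCell (M : ℝ)⁻¹ z := by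
    intro k
    set s : ℝ := (((n : ℝ) ^ k)⁻¹) ^ ((d : ℝ)⁻¹) with hs
    have hs0 : 0 < s := by positivity
    have hsd : s ^ d = ((n : ℝ) ^ k)⁻¹ := Real.rpow_inv_natCast_pow (by positivity) hd
    have hvol : ∀ p : Fin (n ^ k), volume (G k p) = ENNReal.ofReal (s ^ d) := by
      intro p
      rw [hsd, ENNReal.ofReal_inv_of_pos (by positivity), ENNReal.ofReal_pow hn0.le,
        ENNReal.ofReal_natCast]
      exact ENNReal.eq_inv_of_mul_eq_one_left (by rw [mul_comm]; exact R.volume_eq k p)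
    obtain ⟨M, hM, h1, h2⟩ := exists_grid hd hs0 (fun p : Fin (n ^ k) => R.isHypercube k p) hvol
      (fun p p' hne => R.disjoint k p p' p.2 p'.2 fun h => hne (Fin.ext h)) (R.iUnion_eq k)
    have hsM : s = (M : ℝ)⁻¹ := eq_inv_of_mul_eq_one_left hM
    rw [hsM] at h1 h2 hsd
    refine ⟨M, ?_, fun z hz => ?_, fun p hp => h2 ⟨p, hp⟩⟩
    · rw [inv_pow, inv_inj] at hsd
      exact_mod_cast hsd
    · obtain ⟨p, hp⟩ := h1 z hz
      exact ⟨p, p.2, hp⟩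
  obtain ⟨m, hm, -⟩ := key 1
  rw [pow_one] at hm
  refine ⟨m, ?_, hm, fun k => ?_⟩
  · by_contra! h
    have : m ^ d ≤ 1 := Nat.pow_le_one_iff hd |>.2 (by omega)
    omega
  · obtain ⟨M, hM, h⟩ := key k
    have : M = m ^ k := by
      refine Nat.pow_left_injective hd ?_
      simp only
      rw [hM, ← hm, ← pow_mul, ← pow_mul, mul_comm]
    rw [this] at h
    push_cast at h
    exact h

/-- A union of consecutive tiles that is smaller than the tiles at depth `J` and meets the
interiors of two tiles at depth `K` contains, in the first of these, only points of its last
subtile at depth `J`. -/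
theorem mem_last_subtile (R : CubeRefinement d n G) {k a b K j q q' : ℕ} (hb : b ≤ n ^ k)
    {A : Set (EuclideanSpace ℝ (Fin d))} (hA : A = ⋃ p ∈ Set.Ico a b, G k p)
    (hvol : (n : ℝ≥0∞) ^ (K + j) * volume A < 1) (hq' : q' < n ^ K) (hlt : q < q')
    {x x' : EuclideanSpace ℝ (Fin d)} (hx : x ∈ A) (hxq : x ∈ interior (G K q))
    (hx' : x' ∈ A) (hxq' : x' ∈ interior (G K q')) :
    x ∈ G (K + j) ((q + 1) * n ^ j - 1) := by
  have hn := R.two_le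
  have hq := hlt.trans hq'
  have hmemA : ∀ p ∈ Set.Ico a b, G k p ⊆ A := fun p hp => by
    rw [hA]; exact Set.subset_biUnion_of_mem (u := fun p => G k p) hp
  obtain ⟨p, hp, hxp⟩ : ∃ p ∈ Set.Ico a b, x ∈ G k p := by simpa [hA] using hx
  obtain ⟨p', hp', hxp'⟩ : ∃ p ∈ Set.Ico a b, x' ∈ G k p := by simpa [hA] using hx'
  have hJk := R.lt_of_subset_of_volume_lt hvol (hmemA p hp)
  obtain ⟨h, rfl⟩ : ∃ h, k = K + j + h := ⟨_, (Nat.add_sub_of_le hJk.le).symm⟩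
  have hpn : p < n ^ (K + j + h) := hp.2.trans_le hb
  have hpn' : p' < n ^ (K + j + h) := hp'.2.trans_le hb
  have e : p / n ^ (j + h) = q := by
    rw [add_assoc] at hpn hxp
    exact R.ancestor_eq hpn hq hxp hxq
  have e' : p' / n ^ (j + h) = q' := by
    rw [add_assoc] at hpn' hxp'
    exact R.ancestor_eq hpn' hq' hxp' hxq'
  have hj : 0 < n ^ j := by positivity
  have hh : 0 < n ^ h := by positivity
  have hl : (q + 1) * n ^ j - 1 + 1 = (q + 1) * n ^ j :=
    Nat.sub_add_cancel (Nat.mul_pos (Nat.succ_pos _) hj)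
  set l := (q + 1) * n ^ j - 1
  -- `l` is the last position at depth `K + j` inside tile `q`, and `p / n ^ h` is the ancestor of
  -- `p` at that depth.
  have hle : p / n ^ h ≤ l := by
    have : p / n ^ h / n ^ j = q := by rw [Nat.div_div_eq_div_mul, ← pow_add, add_comm h j, e]
    have := (Nat.div_lt_iff_lt_mul (k := n ^ j) (x := p / n ^ h) (y := q + 1) hj).1 (by omega)
    omega
  rcases hle.lt_or_eq with hlt' | heq
  · exfalso
    -- If `p` came before subtile `l`, all of `l` would lie between `p` and `p'` in the order, hence
    -- in `A`, which is too small for that.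
    refine lt_irrefl (K + j) (R.lt_of_subset_of_volume_lt (p := l) hvol fun y hy => ?_)
    have hln : l < n ^ (K + j) := by
      have : (q + 1) * n ^ j ≤ n ^ K * n ^ j := Nat.mul_le_mul_right _ hq
      rw [← pow_add] at this
      omega
    obtain ⟨r, hr1, hr2, hr3⟩ := R.subset_descendants (K + j) h hln hy
    refine hmemA r ⟨?_, ?_⟩ hr3
    · have h1 : p < (p / n ^ h + 1) * n ^ h := by
        have := Nat.lt_mul_div_succ p hh
        rwa [mul_comm] at this
      have h2 : (p / n ^ h + 1) * n ^ h ≤ l * n ^ h := Nat.mul_le_mul_right _ hlt'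
      have := hp.1
      omega
    · have h1 : (l + 1) * n ^ h ≤ q' * n ^ (j + h) := by
        rw [hl, mul_assoc, ← pow_add]
        exact Nat.mul_le_mul_right _ hlt
      have h2 : q' * n ^ (j + h) ≤ p' := e' ▸ Nat.div_mul_le_self _ _
      have := hp'.2
      omega
  · rw [← heq]
    exact R.subset_ancestor (K + j) h hpn hxp

end CubeRefinement

/-! ### Elementary facts on grids and balls -/

section Grid

variable {d : ℕ}

theorem mem_interior_gridCell_of_forall_lt {s : ℝ} {z : Fin d → ℕ} {x : EuclideanSpace ℝ (Fin d)}
    (hx : ∀ j, s * z j < x j ∧ x j < s * z j + s) : x ∈ interior (gridCell s z) := by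
  have hopen : IsOpen {x : EuclideanSpace ℝ (Fin d) | ∀ j, s * z j < x j ∧ x j < s * z j + s} := by
    simp only [Set.ofPred_forall]
    exact isOpen_iInter_of_finite fun j =>
      isOpen_Ioo.preimage (EuclideanSpace.proj (𝕜 := ℝ) j).continuous
  exact interior_maximal (fun y hy j => ⟨(hy j).1.le, (hy j).2.le⟩) hopen hx

theorem gridCell_injective {s : ℝ} (hs : 0 < s) :
    Function.Injective (gridCell s : (Fin d → ℕ) → Set (EuclideanSpace ℝ (Fin d))) := by
  have key : ∀ z z' : Fin d → ℕ, gridCell s z = gridCell s z' → ∀ j, z' j ≤ z j := by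
    intro z z' h j
    have hmem : (WithLp.toLp 2 fun j => s * z j : EuclideanSpace ℝ (Fin d)) ∈ gridCell s z :=
      fun j => ⟨le_rfl, by simpa using hs.le⟩
    rw [h] at hmem
    exact_mod_cast le_of_mul_le_mul_left (hmem j).1 hs
  exact fun z z' h => funext fun j => le_antisymm (key z' z h.symm j) (key z z' h j)

/-- Bernoulli: `(1 - 1/M) ^ d ≥ 1 - d/M > 1/2`. -/
theorem two_mul_pred_pow_gt {M d : ℕ} (h : 2 * d < M) : M ^ d < 2 * (M - 1) ^ d := by
  have hM : (0 : ℝ) < M := by exact_mod_cast (by omega : 0 < M)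
  have h2 : (2 * d : ℝ) < M := by exact_mod_cast h
  have hM1 : (1 : ℝ) ≤ M := by exact_mod_cast (by omega : 1 ≤ M)
  have h1 : 1 + (d : ℝ) * (-(1 / M)) ≤ (1 + -(1 / (M : ℝ))) ^ d :=
    one_add_mul_le_pow (by
      have : 1 / (M : ℝ) ≤ 1 := by rw [div_le_one hM]; exact hM1
      linarith) d
  have h3 : (1 : ℝ) / 2 < 1 + (d : ℝ) * (-(1 / M)) := by
    have : (d : ℝ) * (1 / M) < 1 / 2 := by
      rw [mul_one_div, div_lt_div_iff₀ hM two_pos]; linarith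
    linarith
  have h4 : ((M : ℝ) - 1) ^ d = M ^ d * (1 + -(1 / (M : ℝ))) ^ d := by
    rw [← mul_pow]; congr 1; field_simp; ring
  have h5 : (M : ℝ) ^ d < 2 * ((M : ℝ) - 1) ^ d := by
    rw [h4]
    have : (0 : ℝ) < (M : ℝ) ^ d := by positivity
    nlinarith
  have h6 : ((M - 1 : ℕ) : ℝ) = (M : ℝ) - 1 := by rw [Nat.cast_sub (by omega)]; simp
  rw [← h6] at h5
  exact_mod_cast h5

theorem abs_sub_le_of_mem_closedBall {x y : EuclideanSpace ℝ (Fin d)} {ρ : ℝ}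
    (h : y ∈ Metric.closedBall x ρ) (j : Fin d) : |y j - x j| ≤ ρ := by
  rw [mem_closedBall_iff_norm] at h
  exact (PiLp.norm_apply_le (y - x) j).trans h

theorem add_smul_single_mem_closedBall (x : EuclideanSpace ℝ (Fin d)) (j : Fin d) (t : ℝ) :
    x + t • EuclideanSpace.single j 1 ∈ Metric.closedBall x |t| := by
  simp [norm_smul]

theorem bounds_of_closedBall_subset_unitCube {x : EuclideanSpace ℝ (Fin d)} {ρ : ℝ} (hρ : 0 ≤ ρ)
    (hsub : Metric.closedBall x ρ ⊆ unitCube d) (j : Fin d) : 0 ≤ x j - ρ ∧ x j + ρ ≤ 1 := by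
  have key : ∀ t : ℝ, |t| = ρ → x j + t ∈ Set.Icc (0 : ℝ) 1 := by
    intro t ht
    have h : x + t • EuclideanSpace.single j 1 ∈ unitCube d :=
      hsub (ht ▸ add_smul_single_mem_closedBall x j t)
    have h' := h j
    rwa [PiLp.add_apply, PiLp.smul_apply, PiLp.single_apply, if_pos rfl, smul_eq_mul,
      mul_one] at h'
  have h1 := key ρ (abs_of_nonneg hρ)
  have h2 := key (-ρ) (by rw [abs_neg, abs_of_nonneg hρ])
  exact ⟨by linarith [h2.1], h1.2⟩

end Grid

/-! ### Covering balls by `2 ^ d` tiles -/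

section UpperBound

variable {d n : ℕ} {G : ℕ → ℕ → Set (EuclideanSpace ℝ (Fin d))}

/-- Every ball is covered by at most `2 ^ d` tiles, of the greatest depth at which the mesh is at
least the diameter of the ball. -/
theorem CubeRefinement.coversBallsWith_tiles (R : CubeRefinement d n G) (hd : d ≠ 0) :
    CoversBallsWith (unitCube d) (fun A => ∃ k, ∃ p < n ^ k, A = G k p) (2 ^ d) := by
  classical
  obtain ⟨m, hm, -, hgrid⟩ := R.exists_mesh hd
  have hm1 : (1 : ℝ) < m := by exact_mod_cast hm
  have hm0 : (0 : ℝ) < m := by linarith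
  set V := volume (Metric.closedBall (0 : EuclideanSpace ℝ (Fin d)) 1) with hV
  have hV0 : V ≠ 0 := (Metric.measure_closedBall_pos volume _ one_pos).ne'
  have hVt : V ≠ ⊤ := measure_closedBall_lt_top.ne
  -- The chosen mesh is below `2 * m * ρ`, so `2 ^ d` cells have total volume at most `(4 * m * ρ) ^
  -- d`, while the ball has volume `ρ ^ d * V`.
  refine ⟨Real.toNNReal ((4 * m) ^ d) * (V.toNNReal)⁻¹, fun x ρ hρ hsub => ?_⟩
  have hx := bounds_of_closedBall_subset_unitCube hρ.le hsub
  obtain ⟨k, hk1, hk2⟩ : ∃ k, (m : ℝ) ^ k ≤ 1 / (2 * ρ) ∧ 1 / (2 * ρ) < (m : ℝ) ^ (k + 1) := by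
    refine exists_nat_pow_near ?_ hm1
    rw [one_le_div (by positivity)]
    have := hx ⟨0, Nat.pos_of_ne_zero hd⟩
    linarith
  rw [le_div_iff₀ (by positivity)] at hk1
  rw [div_lt_iff₀ (by positivity)] at hk2
  set M : ℝ := (m : ℝ) ^ k with hM
  have hM0 : 0 < M := by positivity
  have hMn : ((m ^ k : ℕ) : ℝ) = M := by push_cast; rfl
  have hMpos : 0 < m ^ k := by positivity
  set fl : Fin d → ℕ := fun j => ⌊(x j - ρ) * M⌋₊ with hfl
  have hfl1 : ∀ j, (fl j : ℝ) ≤ (x j - ρ) * M := fun j =>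
    Nat.floor_le (mul_nonneg (hx j).1 hM0.le)
  have hfl2 : ∀ j, (x j - ρ) * M < fl j + 1 := fun j => Nat.lt_floor_add_one _
  -- The cap keeps the upper layer inside the unit cube; it may make cells coincide, which only
  -- lowers their number.
  set z : (Fin d → Fin 2) → Fin d → ℕ := fun e j => min (fl j + e j) (m ^ k - 1) with hz
  refine ⟨Finset.univ.image fun e => gridCell M⁻¹ (z e), ?_, ?_, ?_, ?_⟩
  · refine Finset.card_image_le.trans ?_
    simp
  · intro A hA
    obtain ⟨e, -, rfl⟩ := Finset.mem_image.1 hA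
    obtain ⟨p, hp, h⟩ := (hgrid k).1 (z e) fun j => by simp only [hz]; omega
    exact ⟨k, p, hp, h.symm⟩
  · intro y hy
    have hyU := hsub hy
    have hyx : ∀ j, x j - ρ ≤ y j ∧ y j ≤ x j + ρ := fun j => by
      have := abs_le.1 (abs_sub_le_of_mem_closedBall hy j)
      constructor <;> linarith
    set e : Fin d → Fin 2 := fun j => if y j * M ≤ fl j + 1 then 0 else 1 with he
    refine Set.mem_iUnion₂.2 ⟨_, Finset.mem_image_of_mem _ (Finset.mem_univ e), fun j => ?_⟩
    change M⁻¹ * z e j ≤ y j ∧ y j ≤ M⁻¹ * z e j + M⁻¹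
    have h1 : (x j - ρ) * M ≤ y j * M := mul_le_mul_of_nonneg_right (hyx j).1 hM0.le
    have h2 : y j * M ≤ (x j - ρ) * M + 1 := by
      have : y j * M ≤ (x j + ρ) * M := mul_le_mul_of_nonneg_right (hyx j).2 hM0.le
      linarith
    have h3 : y j * M ≤ M := by nlinarith [(hyU j).2]
    suffices (z e j : ℝ) ≤ y j * M ∧ y j * M ≤ z e j + 1 by
      constructor
      · rw [inv_mul_le_iff₀ hM0]; linarith
      · rw [← mul_add_one, le_inv_mul_iff₀ hM0]; linarith
    have hflM : fl j < m ^ k := by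
      have : (x j - ρ) * M < M := by nlinarith [(hx j).2]
      have : (fl j : ℝ) < (m ^ k : ℕ) := by rw [hMn]; linarith [hfl1 j]
      exact_mod_cast this
    by_cases hc : y j * M ≤ fl j + 1
    · have : z e j = fl j := by simp only [hz, he, hc, if_true]; simp; omega
      rw [this]
      exact ⟨by linarith [hfl1 j], hc⟩
    · have hlt : fl j + 1 < m ^ k := by
        have : ((fl j + 1 : ℕ) : ℝ) < (m ^ k : ℕ) := by rw [hMn]; push_cast; linarith
        exact_mod_cast this
      have : z e j = fl j + 1 := by simp only [hz, he, hc, if_false]; simp; omega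
      rw [this]
      push_cast
      constructor <;> linarith [hfl1 j, hfl2 j]
  · have hcell : ∀ e, volume (gridCell (d := d) M⁻¹ (z e)) = ENNReal.ofReal (M⁻¹ ^ d) := fun e =>
      volume_cubeAt _ (inv_nonneg.2 hM0.le)
    have hsum : ∑ A ∈ Finset.univ.image fun e => gridCell (d := d) M⁻¹ (z e), volume A ≤
        2 ^ d * ENNReal.ofReal (M⁻¹ ^ d) := by
      refine (Finset.sum_le_card_nsmul _ _ (ENNReal.ofReal (M⁻¹ ^ d)) ?_).trans ?_
      · intro A hA
        obtain ⟨e, -, rfl⟩ := Finset.mem_image.1 hA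
        exact (hcell e).le
      · rw [nsmul_eq_mul]
        gcongr
        have : (Finset.univ.image fun e => gridCell (d := d) M⁻¹ (z e)).card ≤ 2 ^ d :=
          Finset.card_image_le.trans (by simp)
        exact_mod_cast this
    refine hsum.trans ?_
    rw [Measure.addHaar_closedBall' _ _ hρ.le, finrank_euclideanSpace_fin, ← hV]
    have hVV : ((V.toNNReal⁻¹ : ℝ≥0) : ℝ≥0∞) * V = 1 := by
      rw [ENNReal.coe_inv (by simp [ENNReal.toNNReal_eq_zero_iff, hV0, hVt]),
        ENNReal.coe_toNNReal hVt, ENNReal.inv_mul_cancel hV0 hVt]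
    rw [ENNReal.coe_mul, mul_comm (ENNReal.ofReal (ρ ^ d)), mul_assoc, ← mul_assoc _ V, hVV,
      one_mul]
    change _ ≤ ENNReal.ofReal ((4 * m) ^ d) * _
    rw [← ENNReal.ofReal_mul (by positivity), ← mul_pow,
      show (2 : ℝ≥0∞) ^ d = ENNReal.ofReal (2 ^ d) by
        rw [ENNReal.ofReal_pow (by norm_num)]; norm_num,
      ← ENNReal.ofReal_mul (by positivity), ← mul_pow]
    refine ENNReal.ofReal_le_ofReal (pow_le_pow_left₀ (by positivity) ?_ d)
    rw [← div_eq_mul_inv, div_le_iff₀ hM0]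
    rw [pow_succ] at hk2
    nlinarith

end UpperBound

/-! ### Lower bounds from balls around grid vertices -/

section LowerBounds

variable {d n : ℕ} {G : ℕ → ℕ → Set (EuclideanSpace ℝ (Fin d))}

/-- If all balls can be covered, then around every inner vertex of the grid at depth `K` there is
a family of at most `a` sets, smaller than the tiles at any given greater depth `J`, that meets the
interiors of all `2 ^ d` adjacent cells near the vertex. -/
theorem exists_small_sets_around_vertex (hd : d ≠ 0) {m : ℕ} (hm : 2 ≤ m) (hmn : m ^ d = n)
    {P : Set (EuclideanSpace ℝ (Fin d)) → Prop} {a : ℕ} (hcov : CoversBallsWith (unitCube d) P a)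
    {K J : ℕ} (hKJ : K < J) (u : Fin d → ℕ) (hu : ∀ j, u j + 1 < m ^ K) :
    ∃ F : Finset (Set (EuclideanSpace ℝ (Fin d))), F.card ≤ a ∧
      (∀ A ∈ F, P A ∧ (n : ℝ≥0∞) ^ J * volume A < 1) ∧
      ∀ e : Fin d → Fin 2, ∃ A ∈ F, ∃ x ∈ A,
        x ∈ interior (gridCell ((m : ℝ) ^ K)⁻¹ fun j => u j + e j) ∧
        ∀ j, |x j - ((m : ℝ) ^ K)⁻¹ * (u j + 1)| ≤ ((m : ℝ) ^ J)⁻¹ := by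
  obtain ⟨c, hc⟩ := hcov
  have hm0 : (0 : ℝ) < m := by exact_mod_cast (by omega : 0 < m)
  have hm1 : (1 : ℝ) < m := by exact_mod_cast (by omega : 1 < m)
  set s : ℝ := ((m : ℝ) ^ K)⁻¹ with hs
  set t : ℝ := ((m : ℝ) ^ J)⁻¹ with ht
  have hs0 : 0 < s := by positivity
  have ht0 : 0 < t := by positivity
  have hts : t < s := inv_strictAnti₀ (by positivity) (pow_lt_pow_right₀ hm1 hKJ)
  have hsK : s * (m : ℝ) ^ K = 1 := inv_mul_cancel₀ (by positivity)
  set V := volume (Metric.closedBall (0 : EuclideanSpace ℝ (Fin d)) 1) with hV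
  have hVt : V ≠ ⊤ := measure_closedBall_lt_top.ne
  -- `β` is so small that `c` times the volume of a ball of radius `β * t` stays below `t ^ d`, the
  -- volume of a tile at depth `J`.
  obtain ⟨β, hβ0, hβ1, hβ⟩ : ∃ β : ℝ, 0 < β ∧ β ≤ 1 ∧
      (c : ℝ≥0∞) * (ENNReal.ofReal (β ^ d) * V) < 1 := by
    have hlt : 0 ≤ (c : ℝ) * V.toReal := by positivity
    refine ⟨((c : ℝ) * V.toReal + 1)⁻¹, by positivity, inv_le_one_of_one_le₀ (by linarith), ?_⟩
    set β : ℝ := ((c : ℝ) * V.toReal + 1)⁻¹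
    have hβ0 : 0 < β := by positivity
    have hβ1 : β ≤ 1 := inv_le_one_of_one_le₀ (by linarith)
    have hβd : β ^ d ≤ β := pow_le_of_le_one hβ0.le hβ1 hd
    rw [← ENNReal.ofReal_toReal hVt, ← ENNReal.ofReal_coe_nnreal,
      ← ENNReal.ofReal_mul (by positivity), ← ENNReal.ofReal_mul (by positivity),
      ENNReal.ofReal_lt_one]
    calc (c : ℝ) * (β ^ d * V.toReal) = (c : ℝ) * V.toReal * β ^ d := by ring
      _ ≤ (c : ℝ) * V.toReal * β := by gcongr
      _ < 1 := by
        rw [← div_eq_mul_inv, div_lt_one (by positivity)]; linarith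
  set ρ : ℝ := β * t with hρ
  have hρ0 : 0 < ρ := by positivity
  have hρt : ρ ≤ t := by nlinarith
  set v : EuclideanSpace ℝ (Fin d) := WithLp.toLp 2 fun j => s * (u j + 1) with hv
  have hvj : ∀ j, v j = s * (u j + 1) := fun j => rfl
  have hsub : Metric.closedBall v ρ ⊆ unitCube d := by
    intro y hy j
    have h := abs_le.1 (abs_sub_le_of_mem_closedBall hy j)
    rw [hvj] at h
    have h1 : ((u j : ℝ) + 1 + 1) ≤ (m : ℝ) ^ K := by exact_mod_cast hu j
    have h2 : s * ((u j : ℝ) + 1 + 1) ≤ 1 :=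
      (mul_le_mul_of_nonneg_left h1 hs0.le).trans_eq hsK
    have h3 : (0 : ℝ) ≤ s * u j := by positivity
    constructor <;> linarith [h.1, h.2]
  obtain ⟨F, hF1, hF2, hF3, hF4⟩ := hc v ρ hρ0 hsub
  have hvol : (n : ℝ≥0∞) ^ J * ((c : ℝ≥0∞) * volume (Metric.closedBall v ρ)) < 1 := by
    have hnt : (n : ℝ≥0∞) ^ J * ENNReal.ofReal (t ^ d) = 1 := by
      have h1 : t ^ d = ((n : ℝ) ^ J)⁻¹ := by
        rw [ht, inv_pow, ← hmn, ← pow_mul, mul_comm, pow_mul]; push_cast; rfl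
      have hn0 : (0 : ℝ) < n := by rw [← hmn]; push_cast; positivity
      rw [h1, ENNReal.ofReal_inv_of_pos (by positivity), ENNReal.ofReal_pow hn0.le,
        ENNReal.ofReal_natCast]
      exact ENNReal.mul_inv_cancel (by
        have : (n : ℝ≥0∞) ≠ 0 := by exact_mod_cast hn0.ne'
        positivity) (ENNReal.pow_ne_top (ENNReal.natCast_ne_top n))
    rw [Measure.addHaar_closedBall' _ _ hρ0.le, finrank_euclideanSpace_fin, ← hV, hρ, mul_pow,
      ENNReal.ofReal_mul (by positivity)]
    calc _ = ((n : ℝ≥0∞) ^ J * ENNReal.ofReal (t ^ d)) *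
          ((c : ℝ≥0∞) * (ENNReal.ofReal (β ^ d) * V)) := by ring
      _ < 1 := by rw [hnt, one_mul]; exact hβ
  refine ⟨F, hF1, fun A hA => ⟨hF2 A hA, lt_of_le_of_lt ?_ hvol⟩, fun e => ?_⟩
  · gcongr
    exact (Finset.single_le_sum (fun B _ => zero_le (a := volume B)) hA).trans hF4
  -- Shifting every coordinate by `±δ` reaches the interior of the cell selected by `e`; the shift
  -- has length `δ * √d ≤ ρ`.
  · set δ : ℝ := ρ / d with hδ
    have hd0 : (0 : ℝ) < d := by exact_mod_cast Nat.pos_of_ne_zero hd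
    have hd1 : (1 : ℝ) ≤ d := by exact_mod_cast Nat.pos_of_ne_zero hd
    have hδ0 : 0 < δ := by positivity
    have hδρ : δ ≤ ρ := div_le_self hρ0.le hd1
    set x : EuclideanSpace ℝ (Fin d) := WithLp.toLp 2 fun j =>
      s * (u j + 1) + δ * (2 * (e j : ℕ) - 1) with hx
    have hxj : ∀ j, x j = s * (u j + 1) + δ * (2 * (e j : ℕ) - 1) := fun j => rfl
    have he : ∀ j, (e j : ℕ) = 0 ∨ (e j : ℕ) = 1 := fun j => by omega
    have hxv : x ∈ Metric.closedBall v ρ := by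
      rw [mem_closedBall_iff_norm, EuclideanSpace.norm_eq]
      refine Real.sqrt_le_iff.2 ⟨hρ0.le, ?_⟩
      have : ∀ j, ‖(x - v) j‖ ^ 2 = δ ^ 2 := by
        intro j
        rw [PiLp.sub_apply, hxj, hvj]
        rcases he j with h | h <;> rw [h, Real.norm_eq_abs, sq_abs] <;> push_cast <;> ring
      rw [Finset.sum_congr rfl fun j _ => this j, Finset.sum_const, Finset.card_univ,
        Fintype.card_fin, nsmul_eq_mul]
      have : (d : ℝ) * δ = ρ := by rw [hδ]; field_simp
      nlinarith
    obtain ⟨A, hA, hxA⟩ := Set.mem_iUnion₂.1 (hF3 hxv)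
    refine ⟨A, hA, x, hxA, mem_interior_gridCell_of_forall_lt fun j => ?_, fun j => ?_⟩
    · rw [hxj]
      rcases he j with h | h <;> rw [h] <;> push_cast <;> constructor <;> linarith
    · rw [← hvj]
      exact (abs_sub_le_of_mem_closedBall hxv j).trans hρt

/-- A covering of all balls by tiles uses at least `2 ^ d` tiles per ball. -/
theorem CubeRefinement.two_pow_le_of_coversBallsWith_tiles (R : CubeRefinement d n G) (hd : d ≠ 0)
    {a : ℕ} (hcov : CoversBallsWith (unitCube d) (fun A => ∃ k, ∃ p < n ^ k, A = G k p) a) :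
    2 ^ d ≤ a := by
  obtain ⟨m, hm, hmn, hgrid⟩ := R.exists_mesh hd
  have hm0 : (0 : ℝ) < m := by exact_mod_cast (by omega : 0 < m)
  obtain ⟨F, hF, hFP, hFe⟩ := exists_small_sets_around_vertex hd hm hmn hcov (K := 1) (J := 2)
    (by norm_num) (fun _ => 0) (fun _ => by rw [pow_one]; omega)
  choose A hAF x hxA hxe _ using hFe
  have hcell : ∀ e : Fin d → Fin 2, ∃ q < n ^ 1,
      G 1 q = gridCell ((m : ℝ) ^ 1)⁻¹ fun j => 0 + (e j : ℕ) := fun e =>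
    (hgrid 1).1 _ fun j => by have := (e j).2; rw [pow_one]; omega
  choose q hq hqe using hcell
  -- A tile this small has depth above 2, so it lies in one cell of depth 1 and cannot meet the
  -- interiors of two.
  have hinj : Function.Injective A := by
    intro e e' hee
    obtain ⟨⟨k, p, hp, hAp⟩, hvol⟩ := hFP _ (hAF e)
    have hk := R.lt_of_subset_of_volume_lt hvol hAp.ge
    obtain ⟨h, rfl⟩ : ∃ h, k = 1 + h := ⟨k - 1, by omega⟩
    have h1 := R.ancestor_eq hp (hq e) (hAp ▸ hxA e) (hqe e ▸ hxe e)
    have h2 := R.ancestor_eq hp (hq e') (hAp ▸ hee ▸ hxA e') (hqe e' ▸ hxe e')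
    have h3 : G 1 (q e) = G 1 (q e') := by rw [← h1, h2]
    rw [hqe, hqe] at h3
    funext j
    have := congrFun (gridCell_injective (by positivity) h3) j
    exact Fin.ext (by simpa using this)
  have := Finset.card_le_card_of_injOn A (s := Finset.univ) (t := F) (fun e _ => hAF e)
    hinj.injOn
  rw [Finset.card_univ] at this
  simpa using this.trans hF

/-- A covering of all balls by unions of consecutive tiles uses at least `2 ^ d - 1` such unions
per ball. -/
theorem CubeRefinement.two_pow_le_of_coversBallsWith_fragments (R : CubeRefinement d n G)
    (hd : d ≠ 0) {a : ℕ} (hcov : CoversBallsWith (unitCube d)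
      (fun A => ∃ k a b, b ≤ n ^ k ∧ A = ⋃ p ∈ Set.Ico a b, G k p) a) :
    2 ^ d - 1 ≤ a := by
  classical
  by_contra! ha
  obtain ⟨m, hm, hmn, hgrid⟩ := R.exists_mesh hd
  have hm0 : (0 : ℝ) < m := by exact_mod_cast (by omega : 0 < m)
  have hm2 : (2 : ℝ) ≤ m := by exact_mod_cast hm
  have hn := R.two_le
  obtain ⟨K, hK⟩ : ∃ K, 2 * d < m ^ K := ⟨2 * d, Nat.lt_pow_self (by omega)⟩
  set s : ℝ := ((m : ℝ) ^ K)⁻¹ with hs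
  set t : ℝ := ((m : ℝ) ^ (K + 2))⁻¹ with ht
  have hs0 : 0 < s := by positivity
  -- Two extra levels suffice because `m ^ 2 ≥ 4`. The factor 3 is one subtile edge plus a distance
  -- `t` at either end, as needed in `hdisj`.
  have hts : 3 * t < s := by
    have e : s = (m : ℝ) ^ 2 * t := by rw [hs, ht, pow_add]; field_simp
    have : 0 < t := by positivity
    have h4 : (4 : ℝ) ≤ (m : ℝ) ^ 2 := by nlinarith
    rw [e]; nlinarith
  -- These are the cells whose last subtile at depth `K + 2` comes within `t` of the vertex `u`.
  set served : (Fin d → ℕ) → Finset ℕ := fun u => (Finset.range (n ^ K)).filter fun q =>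
    ∃ x ∈ G (K + 2) ((q + 1) * n ^ 2 - 1), ∀ j, |x j - s * (u j + 1)| ≤ t with hserved
  have hcard : ∀ u : Fin d → ℕ, (∀ j, u j + 1 < m ^ K) → 2 ≤ (served u).card := by
    intro u hu
    obtain ⟨F, hF, hFP, hFe⟩ := exists_small_sets_around_vertex hd hm hmn hcov (K := K)
      (J := K + 2) (by omega) u hu
    choose A hAF x hxA hxe hxu using hFe
    have hcell : ∀ e : Fin d → Fin 2, ∃ q < n ^ K,
        G K q = gridCell s fun j => u j + (e j : ℕ) := fun e =>
      (hgrid K).1 _ fun j => by have := (e j).2; have := hu j; omega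
    choose q hq hqe using hcell
    have hqinj : Function.Injective q := by
      intro e e' hee
      have h3 : G K (q e) = G K (q e') := by rw [hee]
      rw [hqe, hqe] at h3
      funext j
      have := congrFun (gridCell_injective hs0 h3) j
      exact Fin.ext (by simpa using this)
    have hlast : ∀ e e', A e = A e' → q e < q e' → q e ∈ served u := by
      intro e e' hee hlt
      obtain ⟨⟨k, b, b', hb, hAb⟩, hvol⟩ := hFP _ (hAF e)
      have h := R.mem_last_subtile hb hAb hvol (hq e') hlt (hxA e) (hqe e ▸ hxe e)
        (hee ▸ hxA e') (hqe e' ▸ hxe e')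
      exact Finset.mem_filter.2 ⟨Finset.mem_range.2 (hq e), x e, h, hxu e⟩
    -- When two adjacent cells share a fragment, the earlier one is served. So unserved cells use
    -- distinct fragments and number at most `2 ^ d - 2`.
    set bad : Finset (Fin d → Fin 2) := Finset.univ.filter fun e => q e ∈ served u with hbad
    have h1 : bad.card ≤ (served u).card :=
      Finset.card_le_card_of_injOn q (fun e he => (Finset.mem_filter.1 he).2) hqinj.injOn
    have h2 : badᶜ.card ≤ F.card := by
      refine Finset.card_le_card_of_injOn A (fun e _ => hAF e) fun e he e' he' hee => ?_
      have hne : ∀ e, e ∈ badᶜ → q e ∉ served u := fun e he h =>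
        Finset.mem_compl.1 he (Finset.mem_filter.2 ⟨Finset.mem_univ _, h⟩)
      rcases lt_trichotomy (q e) (q e') with h | h | h
      · exact absurd (hlast e e' hee h) (hne e he)
      · exact hqinj h
      · exact absurd (hlast e' e hee.symm h) (hne e' he')
    have h3 : bad.card + badᶜ.card = 2 ^ d := by
      rw [Finset.card_add_card_compl]; simp
    omega
  set vertices : Finset (Fin d → Fin (m ^ K - 1)) := Finset.univ
  -- Distinct vertices differ by at least `s` in some coordinate, too far for one subtile of edge
  -- `t` to be within `t` of both.
  have hdisj : ∀ w ∈ vertices, ∀ w' ∈ vertices, w ≠ w' →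
      Disjoint (served fun j => w j) (served fun j => w' j) := by
    intro w _ w' _ hne
    refine Finset.disjoint_left.2 fun q hqw hqw' => hne ?_
    obtain ⟨hq, x, hx, hxw⟩ := Finset.mem_filter.1 hqw
    obtain ⟨-, y, hy, hyw⟩ := Finset.mem_filter.1 hqw'
    have hl : (q + 1) * n ^ 2 - 1 < n ^ (K + 2) := by
      have h1 : (q + 1) * n ^ 2 ≤ n ^ K * n ^ 2 :=
        Nat.mul_le_mul_right _ (Finset.mem_range.1 hq)
      have h2 : 0 < (q + 1) * n ^ 2 := by positivity
      rw [← pow_add] at h1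
      omega
    obtain ⟨z, -, hz⟩ := (hgrid (K + 2)).2 _ hl
    rw [hz] at hx hy
    funext j
    have h1 := hx j
    have h2 := hy j
    have h3 := abs_le.1 (hxw j)
    have h4 := abs_le.1 (hyw j)
    change _ ≤ _ ∧ _ ≤ _ at h1 h2
    have h5 : (w j : ℝ) < (w' j : ℕ) + 1 := by
      by_contra! hc
      have := mul_le_mul_of_nonneg_left hc hs0.le
      linarith [h1.1, h1.2, h2.1, h2.2, h3.1, h3.2, h4.1, h4.2]
    have h6 : (w' j : ℝ) < (w j : ℕ) + 1 := by
      by_contra! hc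
      have := mul_le_mul_of_nonneg_left hc hs0.le
      linarith [h1.1, h1.2, h2.1, h2.2, h3.1, h3.2, h4.1, h4.2]
    have h5' : (w j : ℕ) < (w' j : ℕ) + 1 := by exact_mod_cast h5
    have h6' : (w' j : ℕ) < (w j : ℕ) + 1 := by exact_mod_cast h6
    exact Fin.ext (by omega)
  have hsum : ∑ w ∈ vertices, (served fun j => w j).card ≤ n ^ K := by
    rw [← Finset.card_biUnion hdisj]
    refine (Finset.card_le_card (Finset.biUnion_subset.2 fun w _ =>
      Finset.filter_subset _ _)).trans ?_
    rw [Finset.card_range]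
  have hsum' : vertices.card • 2 ≤ ∑ w ∈ vertices, (served fun j => w j).card :=
    Finset.card_nsmul_le_sum _ _ _ fun w _ => hcard _ fun j => by have := (w j).2; omega
  have hv : vertices.card = (m ^ K - 1) ^ d := by simp [vertices]
  have hfin := two_mul_pred_pow_gt hK
  rw [hv, smul_eq_mul] at hsum'
  rw [← pow_mul, mul_comm K d, pow_mul, hmn] at hfin
  omega

end LowerBounds

/-! ### Invariance of coverings under similarity -/

section Transfer

variable {d : ℕ}

theorem DilationEquiv.symm_image_image
    (f : EuclideanSpace ℝ (Fin d) ≃ᵈ EuclideanSpace ℝ (Fin d))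
    (A : Set (EuclideanSpace ℝ (Fin d))) : f.symm '' (f '' A) = A :=
  f.toEquiv.symm_image_image A

theorem DilationEquiv.image_symm_image
    (f : EuclideanSpace ℝ (Fin d) ≃ᵈ EuclideanSpace ℝ (Fin d))
    (A : Set (EuclideanSpace ℝ (Fin d))) : f '' (f.symm '' A) = A :=
  f.toEquiv.image_symm_image A

/-- Covering properties are preserved by similarities. -/
theorem CoversBallsWith.image {U : Set (EuclideanSpace ℝ (Fin d))}
    {P : Set (EuclideanSpace ℝ (Fin d)) → Prop} {a : ℕ} (h : CoversBallsWith U P a)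
    (f : EuclideanSpace ℝ (Fin d) ≃ᵈ EuclideanSpace ℝ (Fin d)) :
    CoversBallsWith (f '' U) (fun A => P (f.symm '' A)) a := by
  classical
  obtain ⟨c, hc⟩ := h
  obtain ⟨s, hs, hvol, -⟩ := f.exists_volume_image
  obtain ⟨s', hs', -, hball⟩ := f.symm.exists_volume_image
  refine ⟨c, fun x ρ hρ hsub => ?_⟩
  have hQ : f '' Metric.closedBall (f.symm x) (s' * ρ) = Metric.closedBall x ρ := by
    rw [← hball, f.image_symm_image]
  obtain ⟨F, hF1, hF2, hF3, hF4⟩ := hc (f.symm x) (s' * ρ) (mul_pos hs' hρ) (by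
    rw [← hball, ← f.symm_image_image U]
    exact Set.image_mono hsub)
  refine ⟨F.image fun A => f '' A, Finset.card_image_le.trans hF1, fun B hB => ?_, ?_, ?_⟩
  · obtain ⟨A, hA, rfl⟩ := Finset.mem_image.1 hB
    rw [f.symm_image_image]
    exact hF2 A hA
  · rw [← hQ]
    rintro _ ⟨y, hy, rfl⟩
    obtain ⟨A, hA, hyA⟩ := Set.mem_iUnion₂.1 (hF3 hy)
    exact Set.mem_iUnion₂.2 ⟨_, Finset.mem_image_of_mem _ hA, Set.mem_image_of_mem f hyA⟩
  · rw [Finset.sum_image fun A _ B _ hAB => f.injective.image_injective hAB, ← hQ]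
    simp only [hvol]
    rw [← Finset.mul_sum, mul_left_comm]
    gcongr

theorem CoversBallsWith.mono {U : Set (EuclideanSpace ℝ (Fin d))}
    {P P' : Set (EuclideanSpace ℝ (Fin d)) → Prop} {a : ℕ} (h : CoversBallsWith U P a)
    (hP : ∀ A, P A → P' A) : CoversBallsWith U P' a := by
  obtain ⟨c, hc⟩ := h
  refine ⟨c, fun x ρ hρ hsub => ?_⟩
  obtain ⟨F, h1, h2, h3⟩ := hc x ρ hρ hsub
  exact ⟨F, h1, fun A hA => hP A (h2 A hA), h3⟩

end Transfer

/-! ### From the unit cube back to tilings and curves -/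

theorem List.exists_Ico_of_infix_map_range {α : Type*} (g : ℕ → α) {N : ℕ} {l : List α}
    (hl : l <:+: (List.range N).map g) :
    ∃ a b, b ≤ N ∧ ∀ x, x ∈ l ↔ ∃ p ∈ Set.Ico a b, g p = x := by
  obtain ⟨l₁, l₂, h⟩ := hl
  have hlen := congrArg List.length h
  simp only [List.length_append, List.length_map, List.length_range] at hlen
  refine ⟨l₁.length, l₁.length + l.length, by omega, fun x => ?_⟩
  have hget : ∀ i (hi : i < l.length), l[i] = g (l₁.length + i) := by
    intro i hi
    have h1 : (l₁ ++ l ++ l₂)[l₁.length + i]'(by simp; omega) = l[i] := by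
      rw [List.getElem_append_left (by simp; omega), List.getElem_append_right (by omega)]
      simp
    rw [← h1]
    simp [h]
  rw [List.mem_iff_getElem]
  constructor
  · rintro ⟨i, hi, rfl⟩
    exact ⟨_, ⟨Nat.le_add_right _ i, by omega⟩, (hget i hi).symm⟩
  · rintro ⟨p, ⟨hp1, hp2⟩, rfl⟩
    obtain ⟨i, rfl⟩ := Nat.exists_eq_add_of_le hp1
    exact ⟨i, by omega, hget i (by omega)⟩

namespace ScanningOrder

variable {d n : ℕ} {T : RecursiveTiling d} {S : ScanningOrder T}

theorem isTile_iff (S : ScanningOrder T) (h : ∀ r, T.size r = n)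
    (A : Set (EuclideanSpace ℝ (Fin d))) :
    T.IsTile A ↔ ∃ k, ∃ p < n ^ k, A = S.tile n k T.root p := by
  simp only [RecursiveTiling.IsTile, mem_tilesAt_iff_mem_scan (S := S), scan_eq_map_tile h,
    List.mem_map, List.mem_range, eq_comm (a := A)]

theorem IsFragment.exists_eq_iUnion (h : ∀ r, T.size r = n)
    {A : Set (EuclideanSpace ℝ (Fin d))} (hA : S.IsFragment A) :
    ∃ k a b, b ≤ n ^ k ∧ A = ⋃ p ∈ Set.Ico a b, S.tile n k T.root p := by
  obtain ⟨k, l, hl, rfl⟩ := hA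
  rw [scan_eq_map_tile h] at hl
  obtain ⟨a, b, hb, hmem⟩ := List.exists_Ico_of_infix_map_range _ hl
  refine ⟨k, a, b, hb, ?_⟩
  ext x
  simp only [Set.mem_iUnion, hmem, exists_prop]
  constructor
  · rintro ⟨_, ⟨p, hp, rfl⟩, hx⟩
    exact ⟨p, hp, hx⟩
  · rintro ⟨p, hp, hx⟩
    exact ⟨_, ⟨p, hp, rfl⟩, hx⟩

theorem isFragment_of_isTile {A : Set (EuclideanSpace ℝ (Fin d))} (hA : T.IsTile A) :
    S.IsFragment A := by
  obtain ⟨k, hk⟩ := hA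
  rw [mem_tilesAt_iff_mem_scan (S := S)] at hk
  obtain ⟨l₁, l₂, h⟩ := List.append_of_mem hk
  exact ⟨k, [A], ⟨l₁, l₂, by simp [h]⟩, by simp⟩

/-- The tiles, transformed by the similarity that maps the unit tile onto the unit cube. -/
theorem cubeRefinement (S : ScanningOrder T) (h : ∀ r, T.size r = n)
    (hT : T.IsUniformHypercubeTiling)
    (f : EuclideanSpace ℝ (Fin d) ≃ᵈ EuclideanSpace ℝ (Fin d))
    (hf : T.unitTile = f '' unitCube d) :
    CubeRefinement d n fun k p => f.symm '' S.tile n k T.root p where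
  two_le := two_le_of_size_eq h
  zero := by
    change f.symm '' T.unitTile = _
    rw [hf, f.symm_image_image]
  subdivide k p hp := by rw [tile_eq_iUnion h k _ hp, Set.image_iUnion]
  disjoint k p p' hp hp' hne := by
    rw [DilationEquiv.interior_image, DilationEquiv.interior_image,
      Set.disjoint_image_iff f.symm.injective]
    exact disjoint_interior_tile h k _ hp hp' hne
  isHypercube k p := (isHypercube_tile hT.2 k _ p).image _
  volume_eq k p := by
    obtain ⟨s, -, hs, -⟩ := f.symm.exists_volume_image
    rw [hs, mul_left_comm, volume_tile h hT, ← hs]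
    change volume (f.symm '' T.unitTile) = _
    rw [hf, f.symm_image_image, volume_unitCube]

theorem coversBallsWith_isTile (S : ScanningOrder T) (hd : d ≠ 0)
    (hT : T.IsUniformHypercubeTiling) : CoversBallsWith T.unitTile T.IsTile (2 ^ d) := by
  obtain ⟨f, hf⟩ := isHypercube_iff.1 (hT.2 T.root)
  have h : ∀ r, T.size r = T.size T.root := fun r => hT.1.2.1 r T.root
  have R := S.cubeRefinement h hT f hf
  have := (R.coversBallsWith_tiles hd).image f
  rw [← hf] at this
  refine this.mono fun A => ?_
  rintro ⟨k, p, hp, hA⟩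
  exact (S.isTile_iff h A).2 ⟨k, p, hp, f.symm.injective.image_injective hA⟩

theorem two_pow_le_of_coversBallsWith_isTile (S : ScanningOrder T) (hd : d ≠ 0)
    (hT : T.IsUniformHypercubeTiling) {a : ℕ} (ha : CoversBallsWith T.unitTile T.IsTile a) :
    2 ^ d ≤ a := by
  obtain ⟨f, hf⟩ := isHypercube_iff.1 (hT.2 T.root)
  have h : ∀ r, T.size r = T.size T.root := fun r => hT.1.2.1 r T.root
  have R := S.cubeRefinement h hT f hf
  have hU : f.symm '' T.unitTile = unitCube d := R.zero
  have hcov := ha.image f.symm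
  rw [hU] at hcov
  refine R.two_pow_le_of_coversBallsWith_tiles hd (hcov.mono fun A hA => ?_)
  obtain ⟨k, p, hp, hA⟩ := (S.isTile_iff h _).1 hA
  exact ⟨k, p, hp, by rw [← hA]; exact (f.symm_image_image A).symm⟩

theorem two_pow_le_of_coversBallsWith_isFragment (S : ScanningOrder T) (hd : d ≠ 0)
    (hT : T.IsUniformHypercubeTiling) {a : ℕ} (ha : CoversBallsWith T.unitTile S.IsFragment a) :
    2 ^ d - 1 ≤ a := by
  obtain ⟨f, hf⟩ := isHypercube_iff.1 (hT.2 T.root)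
  have h : ∀ r, T.size r = T.size T.root := fun r => hT.1.2.1 r T.root
  have R := S.cubeRefinement h hT f hf
  have hU : f.symm '' T.unitTile = unitCube d := R.zero
  have hcov := ha.image f.symm
  rw [hU] at hcov
  refine R.two_pow_le_of_coversBallsWith_fragments hd (hcov.mono fun A hA => ?_)
  obtain ⟨k, b, b', hb, hA⟩ := hA.exists_eq_iUnion h
  refine ⟨k, b, b', hb, ?_⟩
  simp only [← Set.image_iUnion]
  rw [← hA]
  exact (f.symm_image_image A).symm

end ScanningOrder

theorem mainTheorem7 :
    (∀ (d : ℕ), 1 ≤ d → ∀ T : RecursiveTiling d, T.IsUniformHypercubeTiling →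
      T.IsArrwwidNumber (2 ^ d) ∧
      ∀ S : ScanningOrder T, ∃ a : ℕ, S.IsArrwwidNumber a ∧ (a = 2 ^ d - 1 ∨ a = 2 ^ d)) ∧
    (∀ T : RecursiveTiling 3, T.IsUniformHypercubeTiling →
      ∀ (S : ScanningOrder T) (a : ℕ), S.IsArrwwidNumber a → 7 ≤ a) := by
  refine ⟨fun d hd T hT => ⟨?_, fun S => ?_⟩, fun T hT S a ha => ?_⟩
  -- An arbitrary order, needed only to number the tiles.
  · have S : ScanningOrder T := ⟨fun r => Equiv.refl _, fun _ _ => false⟩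
    exact ⟨S.coversBallsWith_isTile (by omega) hT,
      fun a ha => S.two_pow_le_of_coversBallsWith_isTile (by omega) hT ha⟩
  · have hcov : CoversBallsWith T.unitTile S.IsFragment (2 ^ d) :=
      (S.coversBallsWith_isTile (by omega) hT).mono fun A => ScanningOrder.isFragment_of_isTile
    have hlow : ∀ a, CoversBallsWith T.unitTile S.IsFragment a → 2 ^ d - 1 ≤ a := fun a ha =>
      S.two_pow_le_of_coversBallsWith_isFragment (by omega) hT ha
    by_cases h : CoversBallsWith T.unitTile S.IsFragment (2 ^ d - 1)
    · exact ⟨_, ⟨h, hlow⟩, Or.inl rfl⟩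
    · refine ⟨_, ⟨hcov, fun a ha => ?_⟩, Or.inr rfl⟩
      have h1 := hlow a ha
      have h2 : a ≠ 2 ^ d - 1 := fun e => h (e ▸ ha)
      omega
  · exact S.two_pow_le_of_coversBallsWith_isFragment (by norm_num) hT ha.1
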